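/- Let $n \ge 3$ and equip $S^{n-1} = \{x \in \mathbb{R}^n : \|x\| = 1\}$ with its rotation-invariant (Lebesgue) probability measure. For $\delta \in [-1,1]$ let $T_\delta$ be the bounded operator on the complex Hilbert space $L^2(S^{n-1})$ for which $(T_\delta f)(x)$ is, for almost every $x$, the average of $f$ over $\{y \in S^{n-1} : \langle x, y\rangle = \delta\}$ with respect to its rotation-invariant probability measure. For $p \in [1,\infty)$ let $S^p$ be the Schatten class of bounded operators $T$ on $L^2(S^{n-1})$ with $\|T\|_{S^p} = \mathrm{Tr}(|T|^p)^{1/p} < \infty$, and let $S^\infty$ be the space of compact operators with the operator norm. Let $p \in (2 + \frac{2}{n-2}, \infty]$. Then: 1. $T_\delta \in S^p$ for every $\delta \in (-1,1)$. 2. There are constants $C_p \ge 2$ and $\alpha_p \in (0,1)$, depending only on $n$ and $p$, such that for all $\delta \in [-\frac12, \frac12]$ $$\|T_0 - T_\delta\|_{S^p} \le C_p |\delta|^{\alpha_p}.$$ -/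

import Mathlib

open MeasureTheory Metric Set
open scoped ENNReal Pointwise

namespace SphereMean
set_option linter.unusedSectionVars false

section Uniform

variable (E : Type*) [NormedAddCommGroup E] [InnerProductSpace ℝ E] [FiniteDimensional ℝ E]
  [MeasurableSpace E] [BorelSpace E]

/-- The rotation-invariant (Lebesgue) probability measure on the unit sphere of `E`: the surface
measure `volume.toSphere` divided by its total mass. -/
noncomputable def uniformSphere : Measure (sphere (0 : E) 1) :=
  ((volume : Measure E).toSphere univ)⁻¹ • (volume : Measure E).toSphere

instance [Nontrivial E] : IsProbabilityMeasure (uniformSphere E) := by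
  refine ⟨?_⟩
  rw [uniformSphere, Measure.smul_apply, smul_eq_mul]
  refine ENNReal.inv_mul_cancel ?_ (measure_ne_top _ _)
  exact (Measure.measure_univ_ne_zero).2 (Measure.toSphere_ne_zero _)

variable {E}

/-- Invariance of a measure under all orthogonal hyperplane reflections. -/
def ReflInvariant (ν : Measure E) : Prop :=
  ∀ v : E, ν.map (ℝ ∙ v)ᗮ.reflection = ν

theorem refl_apply (v z : E) :
    (ℝ ∙ v)ᗮ.reflection z = z - (2 * (inner ℝ v z / ‖v‖ ^ 2)) • v := by
  rw [Submodule.reflection_orthogonal_apply, Submodule.reflection_singleton_apply]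
  simp [mul_smul, two_smul]

theorem charFun_eq_of_norm {ν : Measure E} (h : ReflInvariant ν) {s t : E} (hst : ‖s‖ = ‖t‖) :
    charFun ν s = charFun ν t := by
  conv_lhs => rw [← h (s - t)]
  rw [charFun_apply, charFun_apply, integral_map (by fun_prop) (by fun_prop)]
  congr with x
  congr 3
  have h1 := LinearIsometryEquiv.inner_map_map (ℝ ∙ (s - t))ᗮ.reflection x
    ((ℝ ∙ (s - t))ᗮ.reflection s)
  rw [Submodule.reflection_reflection] at h1
  rw [h1, Submodule.reflection_sub hst]

theorem eq_of_reflInvariant {ν ν' : Measure E} [IsProbabilityMeasure ν] [IsProbabilityMeasure ν']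
    (h : ReflInvariant ν) (h' : ReflInvariant ν')
    (hν : ∀ᵐ x ∂ν, ‖x‖ = 1) (hν' : ∀ᵐ x ∂ν', ‖x‖ = 1) : ν = ν' := by
  apply Measure.ext_of_charFun
  ext t
  have key : ∀ {ρ ρ' : Measure E} [IsProbabilityMeasure ρ] [IsProbabilityMeasure ρ'],
      ReflInvariant ρ → (∀ᵐ x ∂ρ', ‖x‖ = 1) →
      ∫ y, charFun ρ (‖t‖ • y) ∂ρ' = charFun ρ t := by
    intro ρ ρ' _ _ hρ hρ'
    have : ∀ᵐ y ∂ρ', charFun ρ (‖t‖ • y) = charFun ρ t := by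
      filter_upwards [hρ'] with y hy
      exact charFun_eq_of_norm hρ (by simp [norm_smul, hy])
    rw [integral_congr_ae this]
    simp
  rw [← key h hν', ← key h' hν]
  simp only [charFun_apply]
  rw [integral_integral_swap]
  · congr with x
    congr with y
    congr 3
    rw [inner_smul_right, inner_smul_right, real_inner_comm]
  · refine Integrable.of_bound (C := 1) (by fun_prop) (.of_forall fun z => ?_)
    simp only [Function.uncurry]
    rw [Complex.norm_exp_ofReal_mul_I]

theorem map_uniformSphere_refl : ReflInvariant ((uniformSphere E).map Subtype.val) := by
  intro v
  set R := (ℝ ∙ v)ᗮ.reflection with hR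
  ext A hA
  rw [Measure.map_apply (by fun_prop) hA, Measure.map_apply (by fun_prop) (by measurability),
    Measure.map_apply (by fun_prop) hA]
  simp only [uniformSphere, Measure.smul_apply]
  congr 1
  rw [Measure.toSphere_apply' _ (measurable_subtype_coe (by measurability)),
    Measure.toSphere_apply' _ (measurable_subtype_coe hA)]
  congr 1
  have : Ioo (0:ℝ) 1 • (Subtype.val '' (Subtype.val ⁻¹' (R ⁻¹' A) : Set (sphere (0:E) 1)))
      = R ⁻¹' (Ioo (0:ℝ) 1 • (Subtype.val '' (Subtype.val ⁻¹' A : Set (sphere (0:E) 1)))) := by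
    ext z
    simp only [Set.mem_smul, Subtype.image_preimage_coe, mem_inter_iff, mem_preimage,
      mem_sphere_iff_norm, sub_zero]
    constructor
    · rintro ⟨r, hr, w, ⟨hw, hw'⟩, rfl⟩
      exact ⟨r, hr, R w, ⟨by simpa using hw, hw'⟩, by simp⟩
    · rintro ⟨r, hr, w, ⟨hw, hw'⟩, h⟩
      refine ⟨r, hr, R.symm w, ⟨by simpa using hw, by simpa using hw'⟩, ?_⟩
      rw [← map_smul, h]; simp
  rw [this]
  exact (LinearIsometryEquiv.measurePreserving R).measure_preimage_emb
    R.toHomeomorph.measurableEmbedding _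

theorem map_uniformSphere_norm : ∀ᵐ x ∂(uniformSphere E).map Subtype.val, ‖x‖ = 1 := by
  rw [ae_map_iff (by fun_prop) (measurableSet_eq_fun (by fun_prop) (by fun_prop))]
  exact .of_forall fun x => by simp

/-- The uniform probability measure on the unit ball (only used in proofs). -/
noncomputable def ballProb (E : Type*) [NormedAddCommGroup E] [InnerProductSpace ℝ E]
    [FiniteDimensional ℝ E] [MeasurableSpace E] [BorelSpace E] : Measure E :=
  ProbabilityTheory.cond volume (ball (0 : E) 1)

instance : IsProbabilityMeasure (ballProb E) :=
  ProbabilityTheory.cond_isProbabilityMeasure_of_finite (measure_ball_pos _ _ one_pos).ne'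
    measure_ball_lt_top.ne

theorem ballProb_refl : ReflInvariant (ballProb E) := by
  intro v
  set R := (ℝ ∙ v)ᗮ.reflection with hR
  ext A hA
  rw [Measure.map_apply (by fun_prop) hA, ballProb, ProbabilityTheory.cond_apply measurableSet_ball,
    ProbabilityTheory.cond_apply measurableSet_ball]
  congr 1
  have : ball (0:E) 1 ∩ R ⁻¹' A = R ⁻¹' (ball (0:E) 1 ∩ A) := by
    ext z; simp
  rw [this]
  exact (LinearIsometryEquiv.measurePreserving R).measure_preimage_emb
    R.toHomeomorph.measurableEmbedding _

theorem ballProb_span (hE : 2 ≤ Module.finrank ℝ E) (x : E) :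
    ∀ᵐ z ∂ballProb E, z ∉ (ℝ ∙ x) := by
  have h : (volume : Measure E) ((ℝ ∙ x : Submodule ℝ E) : Set E) = 0 := by
    apply Measure.addHaar_submodule
    intro h
    have h1 := finrank_span_le_card (R := ℝ) ({x} : Set E)
    rw [h, finrank_top] at h1
    simp at h1
    omega
  exact (ProbabilityTheory.cond_absolutelyContinuous) (by simpa [compl_ofPred] using h)

/-- An auxiliary map, only used in proofs: `δ x + √(1 - δ²) w / ‖w‖`, with `w` the component of `z`
orthogonal to the unit vector `x`. -/
noncomputable def slicePt (δ : ℝ) (x z : E) : E :=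
  δ • x + √(1 - δ ^ 2) • (‖z - inner ℝ x z • x‖⁻¹ • (z - inner ℝ x z • x))

/-- The map `u ↦ δ x + √(1 - δ²) u` from the unit sphere of the hyperplane `xᗮ` to the unit sphere
of `E`; for `|δ| < 1` it is a similarity onto the slice `{y | ⟪x, y⟫ = δ}`, and for `δ = ± 1` it is
constant, equal to `± x`. -/
noncomputable def sliceEmb (δ : Icc (-1 : ℝ) 1) (x : sphere (0 : E) 1)
    (u : sphere (0 : (ℝ ∙ (x : E))ᗮ) 1) : sphere (0 : E) 1 :=
  ⟨(δ : ℝ) • (x : E) + √(1 - (δ : ℝ) ^ 2) • ((u : (ℝ ∙ (x : E))ᗮ) : E), by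
    have hx : ‖(x : E)‖ = 1 := by simp
    have hu : ‖((u : (ℝ ∙ (x : E))ᗮ) : E)‖ = 1 := by
      rw [← Submodule.coe_norm]; simp
    have hxu : inner ℝ (x : E) ((u : (ℝ ∙ (x : E))ᗮ) : E) = 0 :=
      Submodule.mem_orthogonal_singleton_iff_inner_right.1 (u : (ℝ ∙ (x : E))ᗮ).2
    have hδ : 0 ≤ 1 - (δ : ℝ) ^ 2 := by
      have := δ.2.1; have := δ.2.2; nlinarith
    rw [mem_sphere_zero_iff_norm, ← sq_eq_sq₀ (norm_nonneg _) zero_le_one,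
      norm_add_sq_real, norm_smul, norm_smul, inner_smul_left, inner_smul_right, hx, hu, hxu]
    simp [Real.sq_sqrt hδ]⟩

theorem inner_sliceEmb (δ : Icc (-1 : ℝ) 1) (x : sphere (0 : E) 1)
    (u : sphere (0 : (ℝ ∙ (x : E))ᗮ) 1) : inner ℝ (x : E) (sliceEmb δ x u : E) = δ := by
  have hxu : inner ℝ (x : E) ((u : (ℝ ∙ (x : E))ᗮ) : E) = 0 :=
    Submodule.mem_orthogonal_singleton_iff_inner_right.1 (u : (ℝ ∙ (x : E))ᗮ).2
  simp [sliceEmb, inner_add_right, inner_smul_right, hxu]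

/-- The uniform probability measure on the slice `{y | ⟪x, y⟫ = δ}` of the unit sphere. -/
noncomputable def sliceMeasure (δ : Icc (-1 : ℝ) 1) (x : sphere (0 : E) 1) :
    Measure (sphere (0 : E) 1) :=
  (uniformSphere (ℝ ∙ (x : E))ᗮ).map (sliceEmb δ x)

theorem continuous_sliceEmb (δ : Icc (-1 : ℝ) 1) (x : sphere (0 : E) 1) :
    Continuous (sliceEmb δ x) := by
  unfold sliceEmb
  fun_prop

theorem nontrivial_orth (hE : 2 ≤ Module.finrank ℝ E) (x : E) : Nontrivial (ℝ ∙ x)ᗮ := by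
  have h1 := finrank_span_le_card (R := ℝ) ({x} : Set E)
  have h2 := Submodule.finrank_add_finrank_orthogonal (ℝ ∙ x)
  simp at h1
  exact Module.nontrivial_of_finrank_pos (R := ℝ) (by omega)

theorem isProb_slice (hE : 2 ≤ Module.finrank ℝ E) (δ : Icc (-1 : ℝ) 1) (x : sphere (0 : E) 1) :
    IsProbabilityMeasure (sliceMeasure δ x) := by
  have := nontrivial_orth hE (x : E)
  exact Measure.isProbabilityMeasure_map (continuous_sliceEmb δ x).aemeasurable

theorem proj_val (x : E) (hx : ‖x‖ = 1) (z : E) :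
    (((ℝ ∙ x)ᗮ.orthogonalProjectionOnto z : (ℝ ∙ x)ᗮ) : E) = z - inner ℝ x z • x := by
  rw [Submodule.orthogonalProjectionOnto_orthogonal]
  simp [Submodule.starProjection_unit_singleton ℝ hx]

/-- On the unit sphere of `xᗮ`, the uniform measure is the law of the normalized projection. -/
theorem map_uniformSphere_orth (hE : 2 ≤ Module.finrank ℝ E) (x : E) (hx : ‖x‖ = 1) :
    (uniformSphere (ℝ ∙ x)ᗮ).map Subtype.val =
      (ballProb E).map (fun z => ‖(ℝ ∙ x)ᗮ.orthogonalProjectionOnto z‖⁻¹ •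
        (ℝ ∙ x)ᗮ.orthogonalProjectionOnto z) := by
  have := nontrivial_orth hE x
  have hm : Measurable (fun z : E => ‖(ℝ ∙ x)ᗮ.orthogonalProjectionOnto z‖⁻¹ •
        (ℝ ∙ x)ᗮ.orthogonalProjectionOnto z) := by fun_prop
  have : IsProbabilityMeasure ((uniformSphere (ℝ ∙ x)ᗮ).map Subtype.val) :=
    Measure.isProbabilityMeasure_map (by fun_prop)
  have : IsProbabilityMeasure ((ballProb E).map (fun z =>
      ‖(ℝ ∙ x)ᗮ.orthogonalProjectionOnto z‖⁻¹ • (ℝ ∙ x)ᗮ.orthogonalProjectionOnto z)) :=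
    Measure.isProbabilityMeasure_map hm.aemeasurable
  refine eq_of_reflInvariant map_uniformSphere_refl ?_ map_uniformSphere_norm ?_
  · intro v
    conv_rhs => rw [← ballProb_refl (v : E)]
    rw [Measure.map_map (by fun_prop) hm, Measure.map_map hm (by fun_prop)]
    congr 1
    ext1 z
    have hxv : inner ℝ x (v : E) = 0 := Submodule.mem_orthogonal_singleton_iff_inner_right.1 v.2
    have : (ℝ ∙ x)ᗮ.orthogonalProjectionOnto ((ℝ ∙ (v : E))ᗮ.reflection z)
        = (ℝ ∙ v)ᗮ.reflection ((ℝ ∙ x)ᗮ.orthogonalProjectionOnto z) := by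
      ext
      rw [proj_val x hx, refl_apply, refl_apply]
      simp only [Submodule.coe_sub, Submodule.coe_smul, Submodule.coe_norm, Submodule.coe_inner,
        proj_val x hx]
      rw [inner_sub_right, inner_sub_right, inner_smul_right, inner_smul_right, hxv,
        real_inner_comm x (v : E), hxv]
      simp only [mul_zero, sub_zero]
      abel
    simp only [Function.comp_apply, this, LinearIsometryEquiv.norm_map, map_smul]
  · rw [ae_map_iff hm.aemeasurable (measurableSet_eq_fun (by fun_prop) (by fun_prop))]
    filter_upwards [ballProb_span hE x] with z hz
    have : (ℝ ∙ x)ᗮ.orthogonalProjectionOnto z ≠ 0 := by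
      intro h
      apply hz
      have h2 := congrArg Subtype.val h
      rw [proj_val x hx] at h2
      have h3 : z = inner ℝ x z • x := by simpa [sub_eq_zero] using h2
      rw [h3]
      exact Submodule.smul_mem _ _ (Submodule.mem_span_singleton_self x)
    rw [norm_smul, norm_inv, norm_norm, inv_mul_cancel₀ (norm_ne_zero_iff.2 this)]

theorem map_sliceMeasure (hE : 2 ≤ Module.finrank ℝ E) (δ : Icc (-1 : ℝ) 1)
    (x : sphere (0 : E) 1) :
    (sliceMeasure δ x).map Subtype.val = (ballProb E).map (slicePt δ (x : E)) := by
  have hx : ‖(x : E)‖ = 1 := by simp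
  rw [sliceMeasure, Measure.map_map (by fun_prop) (continuous_sliceEmb δ x).measurable]
  have h1 : (Subtype.val ∘ sliceEmb δ x) =
      (fun w : (ℝ ∙ (x : E))ᗮ => (δ : ℝ) • (x : E) + √(1 - (δ : ℝ) ^ 2) • (w : E)) ∘
        (Subtype.val : sphere (0 : (ℝ ∙ (x : E))ᗮ) 1 → _) := rfl
  rw [h1, ← Measure.map_map (by fun_prop) (by fun_prop), map_uniformSphere_orth hE x hx,
    Measure.map_map (by fun_prop) (by fun_prop)]
  congr 1
  ext1 z
  simp only [Function.comp_apply, slicePt, Submodule.coe_smul, Submodule.coe_norm, proj_val (x : E) hx]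

theorem measurable_slicePt (δ : ℝ) : Measurable (fun q : E × E => slicePt δ q.1 q.2) := by
  unfold slicePt
  fun_prop

theorem slicePt_refl (δ : ℝ) (v x z : E) :
    slicePt δ ((ℝ ∙ v)ᗮ.reflection x) ((ℝ ∙ v)ᗮ.reflection z) =
      (ℝ ∙ v)ᗮ.reflection (slicePt δ x z) := by
  have h : (ℝ ∙ v)ᗮ.reflection z - inner ℝ x z • (ℝ ∙ v)ᗮ.reflection x =
      (ℝ ∙ v)ᗮ.reflection (z - inner ℝ x z • x) := by simp
  simp only [slicePt, LinearIsometryEquiv.inner_map_map, h, LinearIsometryEquiv.norm_map]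
  simp only [map_add, map_smul]

theorem map_slicePt_prod (hE : 2 ≤ Module.finrank ℝ E) (δ : Icc (-1 : ℝ) 1) :
    (((uniformSphere E).map Subtype.val).prod (ballProb E)).map (fun q => slicePt δ q.1 q.2) =
      (uniformSphere E).map Subtype.val := by
  have : Nontrivial E := Module.nontrivial_of_finrank_pos (R := ℝ) (by omega)
  have : IsProbabilityMeasure ((uniformSphere E).map Subtype.val) :=
    Measure.isProbabilityMeasure_map (by fun_prop)
  have hm := measurable_slicePt (E := E) δ
  have := Measure.isProbabilityMeasure_map
    (μ := ((uniformSphere E).map Subtype.val).prod (ballProb E)) hm.aemeasurable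
  refine eq_of_reflInvariant ?_ map_uniformSphere_refl ?_ map_uniformSphere_norm
  · intro v
    rw [Measure.map_map (by fun_prop) hm]
    conv_rhs => rw [← map_uniformSphere_refl v, ← ballProb_refl v,
      Measure.map_prod_map _ _ (by fun_prop) (by fun_prop), Measure.map_map hm (by fun_prop)]
    congr 1
    ext1 q
    simp [slicePt_refl]
  · have hms : MeasurableSet {y : E | ‖y‖ = 1} :=
      measurableSet_eq_fun (by fun_prop) (by fun_prop)
    rw [ae_map_iff hm.aemeasurable hms]
    have hp : ((uniformSphere E).map Subtype.val).prod (ballProb E) =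
        ((uniformSphere E).prod (ballProb E)).map (Prod.map Subtype.val id) := by
      rw [← Measure.map_prod_map _ _ (by fun_prop) (by fun_prop), Measure.map_id]
    have hm' : Measurable (fun q : sphere (0 : E) 1 × E => slicePt δ (q.1 : E) q.2) :=
      hm.comp (by fun_prop : Measurable (Prod.map Subtype.val id))
    rw [hp]
    refine (ae_map_iff (by fun_prop : Measurable (Prod.map Subtype.val id)).aemeasurable
      (hm hms)).2 ?_
    refine (Measure.ae_prod_iff_ae_ae (hm' hms)).2 (.of_forall fun x => ?_)
    have h := map_sliceMeasure hE δ x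
    have hx : Measurable (slicePt (δ : ℝ) (x : E)) :=
      hm.comp (measurable_const.prodMk measurable_id)
    change ∀ᵐ y ∂ballProb E, ‖slicePt (δ : ℝ) (x : E) y‖ = 1
    rw [← ae_map_iff (p := fun y => ‖y‖ = 1) hx.aemeasurable hms, ← h,
      ae_map_iff (by fun_prop) hms]
    exact .of_forall fun y => by simp

theorem sphere_emb : MeasurableEmbedding (Subtype.val : sphere (0 : E) 1 → E) :=
  .subtype_coe isClosed_sphere.measurableSet

theorem measurable_slicePt' (δ : ℝ) :
    Measurable (fun q : sphere (0 : E) 1 × E => slicePt δ (q.1 : E) q.2) :=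
  (measurable_slicePt δ).comp (by fun_prop : Measurable (Prod.map Subtype.val id))

theorem lintegral_sliceMeasure (hE : 2 ≤ Module.finrank ℝ E) (δ : Icc (-1 : ℝ) 1)
    {g : E → ℝ≥0∞} (hg : Measurable g) (x : sphere (0 : E) 1) :
    ∫⁻ y, g y ∂sliceMeasure δ x = ∫⁻ z, g (slicePt δ (x : E) z) ∂ballProb E := by
  have hx : Measurable (slicePt (δ : ℝ) (x : E)) :=
    (measurable_slicePt (δ : ℝ)).comp (measurable_const.prodMk measurable_id)
  rw [← lintegral_map hg hx, ← map_sliceMeasure hE,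
    lintegral_map hg (by fun_prop)]

/-- Averaging over slices preserves the uniform measure. -/
theorem lintegral_slice (hE : 2 ≤ Module.finrank ℝ E) (δ : Icc (-1 : ℝ) 1)
    {g : sphere (0 : E) 1 → ℝ≥0∞} (hg : Measurable g) :
    ∫⁻ x, ∫⁻ y, g y ∂sliceMeasure δ x ∂uniformSphere E = ∫⁻ y, g y ∂uniformSphere E := by
  set G : E → ℝ≥0∞ := Function.extend Subtype.val g 0 with hGdef
  have hG : Measurable G := sphere_emb.measurable_extend hg measurable_const
  have hGg : ∀ y : sphere (0 : E) 1, g y = G y := fun y =>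
    (Subtype.val_injective.extend_apply g 0 y).symm
  simp only [hGg, lintegral_sliceMeasure hE δ hG]
  have : Nontrivial E := Module.nontrivial_of_finrank_pos (R := ℝ) (by omega)
  have : IsProbabilityMeasure ((uniformSphere E).map Subtype.val) :=
    Measure.isProbabilityMeasure_map (by fun_prop)
  rw [← lintegral_map (f := G) (g := Subtype.val) hG (by fun_prop), ← map_slicePt_prod hE δ,
    lintegral_map hG (measurable_slicePt _),
    lintegral_prod (fun q : E × E => G (slicePt δ q.1 q.2))
      (hG.comp (measurable_slicePt _)).aemeasurable, sphere_emb.lintegral_map]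

theorem ae_slice (hE : 2 ≤ Module.finrank ℝ E) (δ : Icc (-1 : ℝ) 1)
    {q : sphere (0 : E) 1 → Prop} (hq : ∀ᵐ y ∂uniformSphere E, q y) :
    ∀ᵐ x ∂uniformSphere E, ∀ᵐ y ∂sliceMeasure δ x, q y := by
  obtain ⟨s, hs, hsm, hs0⟩ := exists_measurable_superset_of_null (ae_iff.1 hq)
  have h1 := lintegral_slice hE δ (g := s.indicator 1) (measurable_one.indicator hsm)
  simp only [lintegral_indicator_one hsm, hs0] at h1
  have hmeas : Measurable fun x : sphere (0 : E) 1 => sliceMeasure δ x s := by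
    have hG : Measurable ((Subtype.val '' s : Set E).indicator (1 : E → ℝ≥0∞)) :=
      measurable_one.indicator (sphere_emb.measurableSet_image.2 hsm)
    have : ∀ x : sphere (0 : E) 1, sliceMeasure δ x s =
        ∫⁻ z, (Subtype.val '' s : Set E).indicator 1 (slicePt δ (x : E) z) ∂ballProb E := by
      intro x
      rw [← lintegral_sliceMeasure hE δ hG, ← lintegral_indicator_one hsm]
      congr with y
      by_cases hy : y ∈ s <;> simp [indicator, hy, -mem_sphere_iff_norm]
    simp only [this]
    exact (hG.comp (measurable_slicePt' (δ : ℝ))).lintegral_prod_right'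
  rw [lintegral_eq_zero_iff hmeas] at h1
  filter_upwards [h1] with x hx
  exact measure_mono_null hs hx

theorem stronglyMeasurable_slice (hE : 2 ≤ Module.finrank ℝ E) (δ : Icc (-1 : ℝ) 1)
    {f : sphere (0 : E) 1 → ℂ} (hf : StronglyMeasurable f) :
    StronglyMeasurable fun x => ∫ y, f y ∂sliceMeasure δ x := by
  set F : E → ℂ := Function.extend Subtype.val f 0 with hFdef
  have hF : Measurable F := sphere_emb.measurable_extend hf.measurable measurable_const
  have : ∀ x, ∫ y, f y ∂sliceMeasure δ x = ∫ z, F (slicePt δ (x : E) z) ∂ballProb E := by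
    intro x
    have hx : Measurable (slicePt (δ : ℝ) (x : E)) := 
      (measurable_slicePt (δ : ℝ)).comp (measurable_const.prodMk measurable_id)
    rw [← integral_map (f := F) hx.aemeasurable hF.aestronglyMeasurable, ← map_sliceMeasure hE,
      sphere_emb.integral_map]
    congr with y
    exact (Subtype.val_injective.extend_apply f 0 y).symm
  simp only [this]
  exact StronglyMeasurable.integral_prod_right'
    (f := fun q : sphere (0 : E) 1 × E => F (slicePt δ (q.1 : E) q.2))
    (hF.comp (measurable_slicePt' (δ : ℝ))).stronglyMeasurable

theorem eLpNorm_slice_le (hE : 2 ≤ Module.finrank ℝ E) (δ : Icc (-1 : ℝ) 1)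
    {f : sphere (0 : E) 1 → ℂ} (hf : StronglyMeasurable f) :
    eLpNorm (fun x => ∫ y, f y ∂sliceMeasure δ x) 2 (uniformSphere E) ≤
      eLpNorm f 2 (uniformSphere E) := by
  simp only [eLpNorm_eq_lintegral_rpow_enorm_toReal two_ne_zero ENNReal.ofNat_ne_top]
  refine ENNReal.rpow_le_rpow ?_ (by simp)
  rw [← lintegral_slice hE δ (g := fun y => ‖f y‖ₑ ^ (2 : ℝ≥0∞).toReal)
    (by have := hf.measurable; fun_prop)]
  refine lintegral_mono fun x => ?_
  have := isProb_slice hE δ x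
  have h1 : ‖∫ y, f y ∂sliceMeasure δ x‖ₑ ≤ eLpNorm f 2 (sliceMeasure δ x) :=
    (enorm_integral_le_lintegral_enorm _).trans
      (by
        rw [← eLpNorm_one_eq_lintegral_enorm]
        exact eLpNorm_le_eLpNorm_of_exponent_le one_le_two hf.aestronglyMeasurable)
  refine (ENNReal.rpow_le_rpow h1 ENNReal.toReal_nonneg).trans ?_
  rw [eLpNorm_eq_lintegral_rpow_enorm_toReal two_ne_zero ENNReal.ofNat_ne_top,
    ← ENNReal.rpow_mul]
  simp

theorem ae_integrable_slice (hE : 2 ≤ Module.finrank ℝ E) (δ : Icc (-1 : ℝ) 1)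
    {f : sphere (0 : E) 1 → ℂ} (hf : StronglyMeasurable f) (hfi : MemLp f 2 (uniformSphere E)) :
    ∀ᵐ x ∂uniformSphere E, Integrable f (sliceMeasure δ x) := by
  have : Nontrivial E := Module.nontrivial_of_finrank_pos (R := ℝ) (by omega)
  have hi : Integrable f (uniformSphere E) := hfi.integrable one_le_two
  have h1 := lintegral_slice hE δ (g := fun y => ‖f y‖ₑ) (by fun_prop)
  have hmeas : Measurable fun x : sphere (0 : E) 1 => ∫⁻ y, ‖f y‖ₑ ∂sliceMeasure δ x := by
    set G : E → ℝ≥0∞ := Function.extend Subtype.val (fun y => ‖f y‖ₑ) 0 with hGdef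
    have hG : Measurable G := sphere_emb.measurable_extend (by fun_prop) measurable_const
    have hGg : ∀ y : sphere (0 : E) 1, ‖f y‖ₑ = G y := fun y =>
      (Subtype.val_injective.extend_apply (fun y => ‖f y‖ₑ) 0 y).symm
    simp only [hGg, lintegral_sliceMeasure hE δ hG]
    exact (hG.comp (measurable_slicePt' (δ : ℝ))).lintegral_prod_right'
  filter_upwards [ae_lt_top hmeas (by rw [h1]; exact hi.2.ne)] with x hx
  exact ⟨hf.aestronglyMeasurable, hx⟩

theorem memLp_slice (hE : 2 ≤ Module.finrank ℝ E) (δ : Icc (-1 : ℝ) 1)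
    (f : Lp ℂ 2 (uniformSphere E)) :
    MemLp (fun x => ∫ y, f y ∂sliceMeasure δ x) 2 (uniformSphere E) :=
  ⟨(stronglyMeasurable_slice hE δ (Lp.stronglyMeasurable f)).aestronglyMeasurable,
    (eLpNorm_slice_le hE δ (Lp.stronglyMeasurable f)).trans_lt (Lp.memLp f).2⟩

/-- The spherical averaging operator `T_δ` on the complex space `L²` of the unit sphere:
`(T_δ f)(x)` is, for almost every `x`, the average of `f` over the slice `{y | ⟪x, y⟫ = δ}`. It is
well defined on classes of functions modulo null sets (`ae_slice`), the average exists for almost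
every `x` (`ae_integrable_slice`), and it is a contraction of `L²`. -/
noncomputable def sphereAverage (hE : 2 ≤ Module.finrank ℝ E) (δ : Icc (-1 : ℝ) 1) :
    Lp ℂ 2 (uniformSphere E) →L[ℂ] Lp ℂ 2 (uniformSphere E) :=
  LinearMap.mkContinuous
    { toFun := fun f => (memLp_slice hE δ f).toLp (fun x => ∫ y, f y ∂sliceMeasure δ x)
      map_add' := fun f g => by
        rw [← MemLp.toLp_add, MemLp.toLp_eq_toLp_iff]
        filter_upwards [ae_slice hE δ (Lp.coeFn_add f g),
          ae_integrable_slice hE δ (Lp.stronglyMeasurable f) (Lp.memLp f),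
          ae_integrable_slice hE δ (Lp.stronglyMeasurable g) (Lp.memLp g)] with x h hf hg
        rw [integral_congr_ae h]
        exact integral_add hf hg
      map_smul' := fun c f => by
        rw [RingHom.id_apply, ← MemLp.toLp_const_smul, MemLp.toLp_eq_toLp_iff]
        filter_upwards [ae_slice hE δ (Lp.coeFn_smul c f)] with x h
        rw [integral_congr_ae h]
        exact integral_smul c f }
    1 fun f => by
      rw [one_mul, LinearMap.coe_mk, AddHom.coe_mk, Lp.norm_toLp, Lp.norm_def]
      exact ENNReal.toReal_mono (Lp.memLp f).2.ne
        (eLpNorm_slice_le hE δ (Lp.stronglyMeasurable f))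

theorem coeFn_sphereAverage (hE : 2 ≤ Module.finrank ℝ E) (δ : Icc (-1 : ℝ) 1)
    (f : Lp ℂ 2 (uniformSphere E)) :
    sphereAverage hE δ f =ᵐ[uniformSphere E] fun x => ∫ y, f y ∂sliceMeasure δ x :=
  (memLp_slice hE δ f).coeFn_toLp

end Uniform

/-- The averaging operator `T_δ` on `L²(S^{n-1})`, where `S^{n-1}` is the unit sphere of the
Euclidean space `ℝⁿ`, `n ≥ 3`. -/
noncomputable def avgOp (n : ℕ) (hn : 3 ≤ n) (δ : Icc (-1 : ℝ) 1) :
    Lp ℂ 2 (uniformSphere (EuclideanSpace ℝ (Fin n))) →L[ℂ]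
      Lp ℂ 2 (uniformSphere (EuclideanSpace ℝ (Fin n))) :=
  sphereAverage (by rw [finrank_euclideanSpace_fin]; omega) δ

section Schatten

variable {H : Type*} [NormedAddCommGroup H] [InnerProductSpace ℂ H] [CompleteSpace H]

/-- The trace of a positive operator computed in the Hilbert basis `b`. -/
noncomputable def traceOn {ι : Type*} (b : HilbertBasis ι ℂ H) (A : H →L[ℂ] H) : ℝ≥0∞ :=
  ∑' i, ENNReal.ofReal (inner ℂ (b i) (A (b i))).re

theorem parseval {ι : Type*} (b : HilbertBasis ι ℂ H) (x : H) :
    ∑' i, ENNReal.ofReal (‖inner ℂ (b i) x‖ ^ 2) = ENNReal.ofReal (‖x‖ ^ 2) := by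
  have h := (Complex.hasSum_re (b.hasSum_inner_mul_inner x x))
  have h2 : ∀ i, (inner ℂ x (b i) * inner ℂ (b i) x).re = ‖inner ℂ (b i) x‖ ^ 2 := by
    intro i
    rw [← inner_conj_symm, mul_comm, Complex.mul_conj, Complex.normSq_eq_norm_sq,
      Complex.ofReal_re]
  simp only [h2] at h
  rw [← ENNReal.ofReal_tsum_of_nonneg (fun i => by positivity) h.summable, h.tsum_eq]
  congr 1
  rw [inner_self_eq_norm_sq_to_K]
  norm_cast

theorem traceOn_eq {ι κ : Type*} (b : HilbertBasis ι ℂ H) (c : HilbertBasis κ ℂ H)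
    (A : H →L[ℂ] H) (hA : 0 ≤ A) : traceOn b A = traceOn c A := by
  set S := CFC.sqrt A with hS
  have hSA : S * S = A := CFC.sqrt_mul_sqrt_self A hA
  have hSs : IsSelfAdjoint S := (CFC.sqrt_nonneg A).isSelfAdjoint
  have hsymm := (ContinuousLinearMap.isSelfAdjoint_iff_isSymmetric.1 hSs)
  have key : ∀ x, (inner ℂ x (A x)).re = ‖S x‖ ^ 2 := by
    intro x
    rw [← hSA, mul_apply_eq_comp]
    have := hsymm x (S x)
    simp only [ContinuousLinearMap.coe_coe] at this
    rw [← this, inner_self_eq_norm_sq_to_K]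
    norm_cast
  simp only [traceOn, key]
  simp only [← parseval c (S (b _)), ← parseval b (S (c _))]
  rw [ENNReal.tsum_comm]
  congr with i
  congr with j
  have := hsymm (c i) (b j)
  simp only [ContinuousLinearMap.coe_coe] at this
  rw [← this, norm_inner_symm]

/-- The trace, in `[0, ∞]`, of a positive operator; it does not depend on the Hilbert basis
(`posTrace_eq`). -/
noncomputable def posTrace (A : H →L[ℂ] H) : ℝ≥0∞ :=
  traceOn (exists_hilbertBasis ℂ H).choose_spec.choose A

theorem posTrace_eq {ι : Type*} (b : HilbertBasis ι ℂ H) {A : H →L[ℂ] H} (hA : 0 ≤ A) :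
    posTrace A = ∑' i, ENNReal.ofReal (inner ℂ (b i) (A (b i))).re :=
  traceOn_eq _ b A hA

open Classical in
/-- The Schatten norm `‖T‖_p = Tr(|T|^p)^{1/p}`, with value `∞` when the trace is infinite; the
norm of `S^∞` is the operator norm. -/
noncomputable def schattenNorm (p : ℝ≥0∞) (T : H →L[ℂ] H) : ℝ≥0∞ :=
  if p = ∞ then ‖T‖ₑ else posTrace (CFC.abs T ^ p.toReal) ^ (1 / p.toReal)

/-- Membership in the Schatten class `S^p`: finiteness of the norm for `p < ∞`, and `S^∞` is the
space of compact operators. -/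
def MemSchatten (p : ℝ≥0∞) (T : H →L[ℂ] H) : Prop :=
  if p = ∞ then IsCompactOperator T else schattenNorm p T < ∞

end Schatten
end SphereMean

/-! Put `N = n - 2`. Every `T_δ` is rotation invariant, so all of them are diagonal in one
decomposition of `L²` into spherical harmonics. On degree `k` the eigenvalue is `φ_k(δ)`, where
`φ_k` is the Gegenbauer polynomial of index `N / 2` with `φ_k(1) = 1`. The Schatten norms are
therefore `ℓ^p` norms of these eigenvalues, counted with the multiplicities `d_k`, and everything is
measured against `h_k = ∫ φ_k(⟪x, e⟫)² dσ(x)`.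

Three estimates suffice: `d_k h_k ≤ 1` and `h_k ≤ N! / (k+1)^N`; for fixed `|δ| < 1`, `|φ_k(δ)| ≤ M
√h_k`; for `|δ| ≤ 1/2`, `|φ_k(0) - φ_k(δ)| ≤ M √h_k ((k+1)|δ|)^α`. They bound the sum of `q`-th
powers by a multiple of `∑ h_k^(q/2-1) (k+1)^(αq)`, hence of `∑ (k+1)^(αq - N(q/2-1))`. This
converges for small `α > 0` exactly when `q > 2 + 2/N`. For `p = ∞` any such finite `q` gives both
compactness and the norm bound.

The pointwise estimates come from an energy of the Gegenbauer equation which is smallest at `0`,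
while its product with `(1 - t²)^N` is largest there (`energy_le`). The eigenvalues come from the
product formula `gegenbauer_product`, applied to slices in `integral_slice_gegenbauer`. Degree-`k`
harmonics enter only as the span of the zonal functions `φ_k(⟪·, y⟫)`: these are reproducing kernels
up to a factor, which bounds the multiplicity (`card_mul_le_of_orthonormal`), and they are total
because a function with vanishing moments is zero (`eq_zero_of_orthogonal_zonal`). -/

namespace SphereMean
set_option linter.unusedSectionVars false

/-! ### Gegenbauer polynomials: recurrences, differential equation, product formula. -/

section Gegenbauer

open Polynomial

/-- The Gegenbauer polynomials of index `N / 2`, normalized to take the value `1` at `1`. -/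
noncomputable def gegenbauer (N : ℕ) : ℕ → ℝ[X]
  | 0 => 1
  | 1 => X
  | k + 2 => C ((k + 1 + N : ℝ)⁻¹) *
      (C (2 * k + 2 + N : ℝ) * X * gegenbauer N (k + 1) - C (k + 1 : ℝ) * gegenbauer N k)

variable (N : ℕ)

@[simp] theorem gegenbauer_zero : gegenbauer N 0 = 1 := by rw [gegenbauer]

@[simp] theorem gegenbauer_one : gegenbauer N 1 = X := by rw [gegenbauer]

theorem gegenbauer_recurrence (k : ℕ) :
    (k + 1 + N : ℝ[X]) * gegenbauer N (k + 2) =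
      (2 * k + 2 + N : ℝ[X]) * X * gegenbauer N (k + 1) - (k + 1 : ℝ[X]) * gegenbauer N k := by
  have h : (k + 1 + N : ℝ[X]) * C ((k + 1 + N : ℝ)⁻¹) = 1 := by
    have h0 : (k + 1 + N : ℝ) ≠ 0 := by positivity
    rw [show (k + 1 + N : ℝ[X]) = C (k + 1 + N : ℝ) by simp, ← C_mul, mul_inv_cancel₀ h0, C_1]
  rw [gegenbauer, ← mul_assoc, h, one_mul]
  simp only [C_add, C_mul, map_natCast, C_1, C_ofNat]

theorem natCast_add_ne_zero (k : ℕ) : (k + 1 + N : ℝ[X]) ≠ 0 := by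
  have h : ((k + 1 + N : ℕ) : ℝ[X]) ≠ 0 := Nat.cast_ne_zero.2 (by omega)
  exact_mod_cast h

theorem one_sub_X_sq_ne_zero : (1 - X ^ 2 : ℝ[X]) ≠ 0 := by
  intro h
  simpa using congrArg (eval 0) h

theorem gegenbauer_eval_one (k : ℕ) : (gegenbauer N k).eval 1 = 1 := by
  induction k using Nat.twoStepInduction with
  | zero => simp
  | one => simp
  | more k h0 h1 =>
    have h := congrArg (eval 1) (gegenbauer_recurrence N k)
    simp [h0, h1] at h
    have h2 : (k + 1 + N : ℝ) ≠ 0 := by positivity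
    exact mul_left_cancel₀ h2 (by linarith)

/-- The two ladder relations are proved together: at the next degree the first follows from the
second and the recurrence, while the second needs both of them and the differentiated recurrence. -/
theorem derivative_gegenbauer_aux (k : ℕ) :
    (1 - X ^ 2) * derivative (gegenbauer N k) =
      (k + N : ℝ[X]) * (X * gegenbauer N k - gegenbauer N (k + 1)) ∧
    (1 - X ^ 2) * derivative (gegenbauer N (k + 1)) =
      (k + 1 : ℝ[X]) * (gegenbauer N k - X * gegenbauer N (k + 1)) := by
  induction k with
  | zero => simp; ring
  | succ k ih =>
    obtain ⟨h0, h1⟩ := ih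
    have r := gegenbauer_recurrence N k
    have r' := congrArg derivative r
    simp only [derivative_mul, derivative_sub, derivative_add, derivative_natCast, derivative_X,
      derivative_one, derivative_ofNat] at r'
    push_cast
    constructor
    · linear_combination h1 + r
    · refine mul_left_cancel₀ (natCast_add_ne_zero N k) ?_
      linear_combination (1 - X ^ 2) * r' - (k + 1) * h0 + (2 * k + 2 + N) * X * h1
        + (k + 2) * X * r

theorem derivative_gegenbauer (k : ℕ) :
    (1 - X ^ 2) * derivative (gegenbauer N k) =
      (k + N : ℝ[X]) * (X * gegenbauer N k - gegenbauer N (k + 1)) :=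
  (derivative_gegenbauer_aux N k).1

theorem derivative_gegenbauer_succ (k : ℕ) :
    (1 - X ^ 2) * derivative (gegenbauer N (k + 1)) =
      (k + 1 : ℝ[X]) * (gegenbauer N k - X * gegenbauer N (k + 1)) :=
  (derivative_gegenbauer_aux N k).2

/-- In the product formula this carries values of the functional on derivatives from degree `k` to
degree `k + 2`. It is the ladder relations after division by `1 - X ^ 2`. -/
theorem derivative_gegenbauer_sub (k : ℕ) :
    (k + 1 + N : ℝ[X]) * (k + N) * derivative (gegenbauer N (k + 2)) -
      (k + 2) * (k + 1) * derivative (gegenbauer N k) =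
      (2 * k + 2 + N) * (k + 2) * (k + N) * gegenbauer N (k + 1) := by
  refine mul_left_cancel₀ one_sub_X_sq_ne_zero ?_
  have h1 := derivative_gegenbauer_succ N (k + 1)
  push_cast at h1
  linear_combination (k + 1 + N : ℝ[X]) * (k + N) * h1
    - (k + 2) * (k + 1) * derivative_gegenbauer N k
    - (k + 2) * (k + N) * X * gegenbauer_recurrence N k

theorem gegenbauer_ode (k : ℕ) :
    (1 - X ^ 2) * derivative (derivative (gegenbauer N k)) =
      (N + 1 : ℝ[X]) * X * derivative (gegenbauer N k) -
        (k * (k + N) : ℝ[X]) * gegenbauer N k := by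
  have h := congrArg derivative (derivative_gegenbauer N k)
  simp only [derivative_mul, derivative_sub, derivative_add, derivative_natCast, derivative_X,
    derivative_one, derivative_X_sq] at h
  refine mul_left_cancel₀ one_sub_X_sq_ne_zero ?_
  simp only [C_ofNat] at h
  linear_combination (1 - X ^ 2) * h + (k + 1) * X * derivative_gegenbauer N k
    - (k + N) * derivative_gegenbauer_succ N k

/-- The product formula for Gegenbauer polynomials, for a functional characterized by an
integration by parts identity. -/
theorem gegenbauer_product (hN : 1 ≤ N) (l : ℝ[X] →ₗ[ℝ] ℝ) (a c : ℝ) (h1 : l 1 = 1)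
    (hl : ∀ p : ℝ[X], l ((C (1 - a ^ 2 - c ^ 2) - X ^ 2 + C (2 * a * c) * X) * derivative p) =
      l (C (N : ℝ) * (X - C (a * c)) * p)) (k : ℕ) :
    l (gegenbauer N k) = (gegenbauer N k).eval a * (gegenbauer N k).eval c := by
  have lC : ∀ (r : ℝ) (p : ℝ[X]), l (C r * p) = r * l p := fun r p => by
    rw [← smul_eq_C_mul, map_smul, smul_eq_mul]
  have hN' : (0 : ℝ) < N := by exact_mod_cast hN
  set A : ℕ → ℝ := fun k => (gegenbauer N k).eval a with hA
  set B : ℕ → ℝ := fun k => (gegenbauer N k).eval c with hB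
  have rA : ∀ k : ℕ, (k + 1 + N : ℝ) * A (k + 2) =
      (2 * k + 2 + N) * a * A (k + 1) - (k + 1) * A k := fun k => by
    simpa using congrArg (eval a) (gegenbauer_recurrence N k)
  have rB : ∀ k : ℕ, (k + 1 + N : ℝ) * B (k + 2) =
      (2 * k + 2 + N) * c * B (k + 1) - (k + 1) * B k := fun k => by
    simpa using congrArg (eval c) (gegenbauer_recurrence N k)
  have hG : ∀ k : ℕ, (k + 1 + N : ℝ) * l (gegenbauer N (k + 2)) =
      (2 * k + 2 + N) * l (X * gegenbauer N (k + 1)) - (k + 1) * l (gegenbauer N k) := fun k => by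
    rw [← lC, ← lC, ← lC, ← map_sub]
    congr 1
    have := gegenbauer_recurrence N k
    simp only [C_add, C_mul, map_natCast, C_1, C_ofNat]
    linear_combination this
  have hD : ∀ k : ℕ, l (derivative (gegenbauer N k)) - l (X ^ 2 * derivative (gegenbauer N k)) =
      (k + N : ℝ) * (l (X * gegenbauer N k) - l (gegenbauer N (k + 1))) := fun k => by
    rw [← map_sub, ← map_sub, ← lC]
    congr 1
    have := derivative_gegenbauer N k
    simp only [C_add, map_natCast]
    linear_combination this
  have hS : ∀ k, (1 - a ^ 2 - c ^ 2) * l (derivative (gegenbauer N k)) -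
      l (X ^ 2 * derivative (gegenbauer N k)) +
      2 * a * c * l (X * derivative (gegenbauer N k)) =
      N * l (X * gegenbauer N k) - N * (a * c) * l (gegenbauer N k) := fun k => by
    rw [← lC, ← lC, ← lC, ← lC, ← map_sub, ← map_sub, ← map_add]
    have := hl (gegenbauer N k)
    convert this using 2
    · ring
    · simp only [C_mul]; ring
  have hX : ∀ k : ℕ, (k + 1 + N : ℝ) * (k + N) * l (derivative (gegenbauer N (k + 2))) -
      (k + 2) * (k + 1) * l (derivative (gegenbauer N k)) =
      (2 * k + 2 + N) * (k + 2) * (k + N) * l (gegenbauer N (k + 1)) := fun k => by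
    rw [← lC, ← lC, ← lC, ← map_sub]
    congr 1
    have := derivative_gegenbauer_sub N k
    simp only [C_add, C_mul, map_natCast, C_1, C_ofNat]
    linear_combination this
  have hX' : ∀ k : ℕ, (k + 1 + N : ℝ) * (k + N) * l (X * derivative (gegenbauer N (k + 2))) -
      (k + 2) * (k + 1) * l (X * derivative (gegenbauer N k)) =
      (2 * k + 2 + N) * (k + 2) * (k + N) * l (X * gegenbauer N (k + 1)) := fun k => by
    rw [← lC, ← lC, ← lC, ← map_sub]
    congr 1
    have := derivative_gegenbauer_sub N k
    simp only [C_add, C_mul, map_natCast, C_1, C_ofNat]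
    linear_combination X * this
  have lX : l X = a * c := by
    have := hS 0
    simp [h1] at this
    have h2 : (N : ℝ) * l X = N * (a * c) := by linarith
    exact mul_left_cancel₀ hN'.ne' h2
  -- the second and third clauses compute the functional on multiples of the derivative
  have key : ∀ k, (l (gegenbauer N k) = A k * B k ∧
      a * l (derivative (gegenbauer N k)) - c * l (X * derivative (gegenbauer N k)) =
        (k + N) * A k * (c * B k - B (k + 1)) ∧
      c * l (derivative (gegenbauer N k)) - a * l (X * derivative (gegenbauer N k)) =
        (k + N) * B k * (a * A k - A (k + 1))) ∧
      (l (gegenbauer N (k + 1)) = A (k + 1) * B (k + 1) ∧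
      a * l (derivative (gegenbauer N (k + 1))) - c * l (X * derivative (gegenbauer N (k + 1))) =
        (k + 1 + N) * A (k + 1) * (c * B (k + 1) - B (k + 2)) ∧
      c * l (derivative (gegenbauer N (k + 1))) - a * l (X * derivative (gegenbauer N (k + 1))) =
        (k + 1 + N) * B (k + 1) * (a * A (k + 1) - A (k + 2))) := by
    -- For `t = ac + √((1 - a²)(1 - c²)) u` one has `(1 - c²) ∂t/∂c = a - ct`. Thus the second
    -- clause is the `c`-derivative of the product formula times `1 - c²`, and the third is its
    -- mirror image in `a`. They stay as linear combinations because the system for the two unknown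
    -- values is singular when `a² = c²`. Two consecutive degrees are carried along because the
    -- recurrence has three terms.
    intro k
    induction k with
    | zero =>
      have rA0 := rA 0
      have rB0 := rB 0
      simp [hA, hB, h1, lX] at rA0 rB0 ⊢
      constructor
      · linear_combination a * rB0
      · linear_combination c * rA0
    | succ k ih =>
      obtain ⟨⟨g0, u0, v0⟩, g1, u1, v1⟩ := ih
      have p1 : (0 : ℝ) < k + 1 + N := by positivity
      have p0 : (0 : ℝ) < k + N := by positivity
      have p2 : (0 : ℝ) < 2 * k + 2 + N := by positivity
      have rA0 := rA k
      have rB0 := rB k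
      have rA1 := rA (k + 1)
      have rB1 := rB (k + 1)
      have hGk := hG k
      have hDk := hD (k + 1)
      have hSk := hS (k + 1)
      have hXk := hX k
      have hX'k := hX' k
      push_cast at rA1 rB1 hDk ⊢
      refine ⟨⟨g1, u1, v1⟩, ?_⟩
      have e : l (gegenbauer N (k + 2)) = A (k + 2) * B (k + 2) := by
        -- Subtracting `hDk` from `hSk` removes `l (X ^ 2 * φ')`. What is left contains `l φ'` and
        -- `l (X * φ')` only through the two combinations `u1` and `v1`, and `hGk` eliminates `l (X
        -- * φ)`.
        have e1 : -((k + 1 + N : ℝ) ^ 2 * l (gegenbauer N (k + 2))) = (2 * k + 2 + N) *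
            (a * ((k + 1 + N) * A (k + 1) * (c * B (k + 1) - B (k + 2))) +
              c * ((k + 1 + N) * B (k + 1) * (a * A (k + 1) - A (k + 2))) -
              N * a * c * (A (k + 1) * B (k + 1))) - (k + 1) ^ 2 * (A k * B k) := by
          linear_combination (2 * k + 2 + N : ℝ) * (hSk - hDk) + (k + 1 : ℝ) * hGk +
            (2 * k + 2 + N : ℝ) * a * u1 + (2 * k + 2 + N : ℝ) * c * v1 -
            (2 * k + 2 + N : ℝ) * N * a * c * g1 - (k + 1 : ℝ) ^ 2 * g0
        refine mul_left_cancel₀ (mul_pos p2 (pow_pos p1 2)).ne' ?_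
        linear_combination -(2 * k + 2 + N : ℝ) * e1 +
          ((2 * k + 2 + N : ℝ) * ((2 * k + 2 + N : ℝ) * c * B (k + 1)) -
            (2 * k + 2 + N : ℝ) * (k + 1 + N) * B (k + 2)) * rA0 +
          ((2 * k + 2 + N : ℝ) * ((k + 1 + N : ℝ) * A (k + 2) + (k + 1) * A k) -
            (2 * k + 2 + N : ℝ) * (k + 1 + N) * A (k + 2)) * rB0
      refine ⟨e, ?_, ?_⟩
      · refine mul_left_cancel₀ (mul_pos p1 p0).ne' ?_
        linear_combination a * hXk - c * hX'k + (k + 2 : ℝ) * (k + 1) * u0 +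
          a * (2 * k + 2 + N) * (k + 2) * (k + N) * g1 + c * (k + 2) * (k + N) * hGk -
          c * (k + 2) * (k + N) * ((k + 1 + N) * e + (k + 1) * g0) -
          (k + 2) * (k + N) * B (k + 1) * rA0 + (k + 1 + N) * (k + N) * A (k + 2) * rB1
      · refine mul_left_cancel₀ (mul_pos p1 p0).ne' ?_
        linear_combination c * hXk - a * hX'k + (k + 2 : ℝ) * (k + 1) * v0 +
          c * (2 * k + 2 + N) * (k + 2) * (k + N) * g1 + a * (k + 2) * (k + N) * hGk -
          a * (k + 2) * (k + N) * ((k + 1 + N) * e + (k + 1) * g0) -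
          (k + 2) * (k + N) * A (k + 1) * rB0 + (k + 1 + N) * (k + N) * B (k + 2) * rA1
  exact (key k).1.1

end Gegenbauer

/-! ### Orthogonality, norms, and pointwise bounds from the energy. -/

section GegenbauerFunctional

open Polynomial

/-- The properties of the functional `p ↦ ∫ p(⟪x, e⟫) dσ(x)` on polynomials, for the uniform
measure `σ` on the unit sphere of dimension `N + 1`. -/
structure IsGegenbauerFunctional (N : ℕ) (I : ℝ[X] →ₗ[ℝ] ℝ) : Prop where
  map_one : I 1 = 1
  by_parts : ∀ p : ℝ[X], I ((1 - X ^ 2) * derivative p) = I (C (N + 1 : ℝ) * (X * p))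
  nonneg : ∀ p : ℝ[X], (∀ t ∈ Icc (-1 : ℝ) 1, 0 ≤ p.eval t) → 0 ≤ I p

variable {N : ℕ} {I : ℝ[X] →ₗ[ℝ] ℝ}

theorem map_C_mul (l : ℝ[X] →ₗ[ℝ] ℝ) (r : ℝ) (p : ℝ[X]) : l (C r * p) = r * l p := by
  rw [← smul_eq_C_mul, map_smul, smul_eq_mul]

namespace IsGegenbauerFunctional

/-- Integration by parts applied to `φ_k' q`, with the differential equation inserted: `φ_k` is an
eigenvector of the Dirichlet form with eigenvalue `k (k + N)`. -/
theorem dirichlet (hI : IsGegenbauerFunctional N I) (k : ℕ) (q : ℝ[X]) :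
    I ((1 - X ^ 2) * (derivative (gegenbauer N k) * derivative q)) =
      k * (k + N) * I (gegenbauer N k * q) := by
  have h := hI.by_parts (derivative (gegenbauer N k) * q)
  rw [← map_C_mul, ← sub_eq_zero, ← map_sub]
  rw [← sub_eq_zero, ← map_sub] at h
  convert h using 2
  simp only [C_add, C_mul, map_natCast, C_1, derivative_mul]
  linear_combination -q * gegenbauer_ode N k

/-- The Dirichlet form is symmetric, and the eigenvalues differ by `(j - k)(j + k + N)`, which is
nonzero. -/
theorem orthogonal (hI : IsGegenbauerFunctional N I) (hN : 1 ≤ N) {j k : ℕ} (hjk : j ≠ k) :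
    I (gegenbauer N j * gegenbauer N k) = 0 := by
  have h1 := hI.dirichlet j (gegenbauer N k)
  have h2 := hI.dirichlet k (gegenbauer N j)
  rw [mul_comm (derivative (gegenbauer N k)), mul_comm (gegenbauer N k), h1] at h2
  have h3 : ((j : ℝ) - k) * (j + k + N) * I (gegenbauer N j * gegenbauer N k) = 0 := by
    linear_combination h2
  have h4 : (j : ℝ) - k ≠ 0 := sub_ne_zero.2 (by exact_mod_cast hjk)
  have h5 : (j + k + N : ℝ) ≠ 0 := by
    have : (1 : ℝ) ≤ N := by exact_mod_cast hN
    positivity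
  simpa [h4, h5] using h3

/-- Pairing the three-term recurrence with its lowest and with its highest term expresses `I (X *
φ_{k+1} * φ_k)` through either of two consecutive square norms. -/
theorem sq_recurrence (hI : IsGegenbauerFunctional N I) (hN : 1 ≤ N) (k : ℕ) :
    (k + N : ℝ) * (2 * k + 2 + N) * I (gegenbauer N (k + 1) * gegenbauer N (k + 1)) =
      (2 * k + N) * (k + 1) * I (gegenbauer N k * gegenbauer N k) := by
  have h1 : (2 * k + 2 + N : ℝ) * I (X * gegenbauer N (k + 1) * gegenbauer N k) =
      (k + 1) * I (gegenbauer N k * gegenbauer N k) := by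
    have h := hI.orthogonal hN (show k + 2 ≠ k by omega)
    have : (k + 1 + N : ℝ) * I (gegenbauer N (k + 2) * gegenbauer N k) =
        (2 * k + 2 + N : ℝ) * I (X * gegenbauer N (k + 1) * gegenbauer N k) -
          (k + 1) * I (gegenbauer N k * gegenbauer N k) := by
      rw [← map_C_mul, ← map_C_mul, ← map_C_mul, ← map_sub]
      congr 1
      simp only [C_add, C_mul, map_natCast, C_1, C_ofNat]
      linear_combination gegenbauer N k * gegenbauer_recurrence N k
    rw [h] at this
    linear_combination -this
  have h2 : (2 * k + N : ℝ) * I (X * gegenbauer N (k + 1) * gegenbauer N k) =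
      (k + N) * I (gegenbauer N (k + 1) * gegenbauer N (k + 1)) := by
    rcases k with _ | k
    · simp
    · have h := hI.orthogonal hN (show k ≠ k + 2 by omega)
      have : (k + 1 + N : ℝ) * I (gegenbauer N (k + 2) * gegenbauer N (k + 2)) =
          (2 * k + 2 + N : ℝ) * I (X * gegenbauer N (k + 2) * gegenbauer N (k + 1)) -
            (k + 1) * I (gegenbauer N k * gegenbauer N (k + 2)) := by
        rw [← map_C_mul, ← map_C_mul, ← map_C_mul, ← map_sub]
        congr 1
        simp only [C_add, C_mul, map_natCast, C_1, C_ofNat]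
        linear_combination gegenbauer N (k + 2) * gegenbauer_recurrence N k
      rw [h] at this
      push_cast
      linear_combination -this
  linear_combination -(2 * k + 2 + N : ℝ) * h2 + (2 * k + N : ℝ) * h1

/-- The ascending factorial is `(k+1)⋯(k+N-1)`, so `1 / h_k` is the dimension of the degree-`k`
spherical harmonics in `N + 2` variables. It has order `k^N`. -/
theorem sq_eq (hI : IsGegenbauerFunctional N I) (hN : 1 ≤ N) (k : ℕ) :
    (2 * k + N : ℝ) * I (gegenbauer N k * gegenbauer N k) * ((k + 1).ascFactorial (N - 1) : ℕ) =
      (N.factorial : ℕ) := by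
  obtain ⟨M, rfl⟩ : ∃ M, N = M + 1 := ⟨N - 1, by omega⟩
  simp only [Nat.add_sub_cancel]
  induction k with
  | zero =>
    simp [hI.map_one, Nat.one_ascFactorial, Nat.factorial_succ]
  | succ k ih =>
    rw [← ih]
    have h := hI.sq_recurrence hN k
    have h2 : ((k + 1 : ℕ) : ℝ) * ((k + 1 + 1).ascFactorial M : ℕ) =
        ((k + M + 1 : ℕ) : ℝ) * ((k + 1).ascFactorial M : ℕ) := by
      have := Nat.succ_ascFactorial (k + 1) M
      rw [show k + 1 + M = k + M + 1 by ring] at this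
      exact_mod_cast this
    push_cast at h h2 ⊢
    have h3 : (k + 1 : ℝ) * (k + M + 1) ≠ 0 := by positivity
    refine mul_left_cancel₀ h3 ?_
    linear_combination (2 * (k + 1) + (M + 1)) * (k + M + 1) * I (gegenbauer (M + 1) (k + 1) *
        gegenbauer (M + 1) (k + 1)) * h2 + (k + M + 1) * ((k + 1).ascFactorial M : ℝ) * h

theorem sq_pos (hI : IsGegenbauerFunctional N I) (hN : 1 ≤ N) (k : ℕ) :
    0 < I (gegenbauer N k * gegenbauer N k) := by
  have h := hI.sq_eq hN k
  refine lt_of_le_of_ne (hI.nonneg _ fun t _ => by simpa using mul_self_nonneg _) fun h0 => ?_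
  rw [← h0] at h
  simp [Nat.factorial_ne_zero, eq_comm] at h

theorem sq_le (hI : IsGegenbauerFunctional N I) (hN : 1 ≤ N) (k : ℕ) :
    I (gegenbauer N k * gegenbauer N k) ≤ N.factorial / (k + 1 : ℝ) ^ N := by
  have h := hI.sq_eq hN k
  have h0 := hI.sq_pos hN k
  rw [le_div_iff₀ (by positivity), ← h]
  have h1 : ((k + 1 : ℝ)) ^ (N - 1) ≤ ((k + 1).ascFactorial (N - 1) : ℕ) := by
    have := Nat.pow_succ_le_ascFactorial (k + 1) (N - 1)
    exact_mod_cast this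
  have h2 : (k + 1 : ℝ) ≤ 2 * k + N := by
    have : (1 : ℝ) ≤ N := by exact_mod_cast hN
    have : (0 : ℝ) ≤ k := by positivity
    linarith
  have h3 : (k + 1 : ℝ) ^ N = (k + 1) * (k + 1 : ℝ) ^ (N - 1) := by
    rw [← pow_succ', Nat.sub_add_cancel hN]
  rw [h3, mul_comm (2 * (k : ℝ) + N), mul_assoc]
  gcongr

end IsGegenbauerFunctional

/-- The energy of the Gegenbauer differential equation. -/
noncomputable def gegenbauerEnergy (N k : ℕ) : ℝ[X] :=
  C (k * (k + N) : ℝ) * (gegenbauer N k * gegenbauer N k) +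
    (1 - X ^ 2) * (derivative (gegenbauer N k) * derivative (gegenbauer N k))

theorem derivative_gegenbauerEnergy (N k : ℕ) :
    derivative (gegenbauerEnergy N k) = C (2 * N : ℝ) * X * derivative (gegenbauer N k) ^ 2 := by
  have h := gegenbauer_ode N k
  simp only [gegenbauerEnergy, derivative_add, derivative_mul, derivative_sub, derivative_one,
    derivative_X_sq, derivative_natCast, C_ofNat, C_mul, C_add, map_natCast]
  linear_combination 2 * derivative (gegenbauer N k) * h

/-- The derivative of the energy is `2 N t φ'²`, which has the sign of `t`. -/
theorem gegenbauerEnergy_zero_le (N k : ℕ) (t : ℝ) :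
    (gegenbauerEnergy N k).eval 0 ≤ (gegenbauerEnergy N k).eval t := by
  have hd : ∀ t, deriv (fun t => (gegenbauerEnergy N k).eval t) t =
      2 * N * t * (derivative (gegenbauer N k)).eval t ^ 2 := fun t => by
    rw [Polynomial.deriv, derivative_gegenbauerEnergy]
    simp
  rcases le_total 0 t with ht | ht
  · refine monotoneOn_of_deriv_nonneg (f := fun t => (gegenbauerEnergy N k).eval t)
      (convex_Ici 0) (by fun_prop) (by fun_prop) (fun x hx => ?_)
      self_mem_Ici ht ht
    rw [interior_Ici] at hx
    rw [hd]
    have := le_of_lt (mem_Ioi.1 hx)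
    positivity
  · refine antitoneOn_of_deriv_nonpos (f := fun t => (gegenbauerEnergy N k).eval t)
      (convex_Iic 0) (by fun_prop) (by fun_prop) (fun x hx => ?_)
      ht self_mem_Iic ht
    rw [interior_Iic] at hx
    rw [hd]
    exact mul_nonpos_of_nonpos_of_nonneg
      (mul_nonpos_of_nonneg_of_nonpos (by positivity) (le_of_lt (mem_Iio.1 hx))) (sq_nonneg _)

/-- The weight reverses the monotonicity: the `φ'²` terms cancel and the derivative becomes `-2 N k
(k + N) t (1 - t²)^(N-1) φ²`. -/
theorem gegenbauerEnergy_weighted_le (N k : ℕ) {t : ℝ} (ht : t ∈ Icc (-1 : ℝ) 1) :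
    (1 - t ^ 2) ^ N * (gegenbauerEnergy N k).eval t ≤ (gegenbauerEnergy N k).eval 0 := by
  rcases N with _ | M
  · have h := gegenbauerEnergy_zero_le 0 k
    have h1 : derivative (gegenbauerEnergy 0 k) = 0 := by simp [derivative_gegenbauerEnergy]
    rw [eq_C_of_derivative_eq_zero h1]
    simp
  set q : ℝ[X] := (1 - X ^ 2) ^ (M + 1) * gegenbauerEnergy (M + 1) k with hq
  have hq' : derivative q = -((1 - X ^ 2) ^ M * C (2 * (M + 1) * (k * (k + (M + 1))) : ℝ) * X *
      gegenbauer (M + 1) k ^ 2) := by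
    rw [hq, derivative_mul, derivative_gegenbauerEnergy, derivative_pow_succ, gegenbauerEnergy]
    simp only [derivative_sub, derivative_one, derivative_X_sq, C_ofNat, C_mul, C_add,
      map_natCast, C_1, Nat.cast_add, Nat.cast_one]
    ring
  have hd : ∀ t, deriv (fun t => q.eval t) t = -((1 - t ^ 2) ^ M * (2 * (M + 1) *
      (k * (k + (M + 1)))) * t * (gegenbauer (M + 1) k).eval t ^ 2) := fun t => by
    rw [Polynomial.deriv, hq']
    simp
  have hq0 : q.eval 0 = (gegenbauerEnergy (M + 1) k).eval 0 := by simp [hq]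
  have hqt : q.eval t = (1 - t ^ 2) ^ (M + 1) * (gegenbauerEnergy (M + 1) k).eval t := by
    simp [hq]
  rw [← hq0, ← hqt]
  have hw : ∀ x ∈ Icc (-1 : ℝ) 1, 0 ≤ 1 - x ^ 2 := fun x hx => by nlinarith [hx.1, hx.2]
  rcases le_total 0 t with h0 | h0
  · refine antitoneOn_of_deriv_nonpos (f := fun t => q.eval t)
      (convex_Icc 0 1) (by fun_prop) (by fun_prop) (fun x hx => ?_)
      ⟨le_rfl, zero_le_one⟩ ⟨h0, ht.2⟩ h0
    rw [interior_Icc] at hx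
    have := hw x ⟨by linarith [hx.1], hx.2.le⟩
    have := hx.1.le
    rw [hd, neg_nonpos]
    positivity
  · refine monotoneOn_of_deriv_nonneg (f := fun t => q.eval t)
      (convex_Icc (-1) 0) (by fun_prop) (by fun_prop)
      (fun x hx => ?_) ⟨ht.1, h0⟩ ⟨by norm_num, le_rfl⟩ h0
    rw [interior_Icc] at hx
    have := hw x ⟨hx.1.le, by linarith [hx.2]⟩
    have h1 : 0 ≤ -x := by linarith [hx.2]
    rw [hd, show ∀ a b c d : ℝ, -(a * b * c * d) = a * b * (-c) * d by intros; ring]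
    positivity

namespace IsGegenbauerFunctional

theorem map_energy (hI : IsGegenbauerFunctional N I) (k : ℕ) :
    I (gegenbauerEnergy N k) = 2 * (k * (k + N)) * I (gegenbauer N k * gegenbauer N k) := by
  rw [gegenbauerEnergy, map_add, map_C_mul, hI.dirichlet]
  ring

/-- The energy at `0` dominates the weighted energy at `t` and is itself at most the mean of the
energy. That mean is explicit: its potential and kinetic parts are equal. -/
theorem energy_le (hI : IsGegenbauerFunctional N I) (k : ℕ) {t : ℝ} (ht : t ∈ Icc (-1 : ℝ) 1) :
    (1 - t ^ 2) ^ N * (gegenbauerEnergy N k).eval t ≤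
      2 * (k * (k + N)) * I (gegenbauer N k * gegenbauer N k) := by
  refine (gegenbauerEnergy_weighted_le N k ht).trans ?_
  have h := hI.nonneg (gegenbauerEnergy N k - C ((gegenbauerEnergy N k).eval 0) * 1) fun t _ => by
    simpa using gegenbauerEnergy_zero_le N k t
  rw [map_sub, map_C_mul, hI.map_one, hI.map_energy] at h
  linarith

theorem eval_sq_le (hI : IsGegenbauerFunctional N I) (k : ℕ) {t : ℝ} (ht : t ∈ Icc (-1 : ℝ) 1) :
    (1 - t ^ 2) ^ N * (gegenbauer N k).eval t ^ 2 ≤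
      2 * I (gegenbauer N k * gegenbauer N k) := by
  have hw : 0 ≤ 1 - t ^ 2 := by nlinarith [ht.1, ht.2]
  -- In degree `0` the factor `k (k + N)` vanishes and the energy carries no information.
  rcases k with _ | k
  · have : (1 - t ^ 2) ^ N ≤ 1 := pow_le_one₀ hw (by nlinarith [sq_nonneg t])
    simp [hI.map_one]
    linarith
  have h := hI.energy_le (k + 1) ht
  simp only [gegenbauerEnergy, eval_add, eval_mul, eval_C, eval_sub, eval_one, eval_pow,
    eval_X] at h
  have hK : (0 : ℝ) < (k + 1 : ℕ) * ((k + 1 : ℕ) + N) := by positivity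
  refine le_of_mul_le_mul_left (a := ((k + 1 : ℕ) * ((k + 1 : ℕ) + N) : ℝ)) ?_ hK
  have : 0 ≤ (1 - t ^ 2) ^ N * ((1 - t ^ 2) * ((derivative (gegenbauer N (k + 1))).eval t *
      (derivative (gegenbauer N (k + 1))).eval t)) :=
    mul_nonneg (pow_nonneg hw _) (mul_nonneg hw (mul_self_nonneg _))
  linarith

theorem eval_derivative_sq_le (hI : IsGegenbauerFunctional N I) (k : ℕ) {t : ℝ}
    (ht : t ∈ Icc (-1 : ℝ) 1) :
    (1 - t ^ 2) ^ (N + 1) * (derivative (gegenbauer N k)).eval t ^ 2 ≤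
      2 * (k * (k + N)) * I (gegenbauer N k * gegenbauer N k) := by
  have hw : 0 ≤ 1 - t ^ 2 := by nlinarith [ht.1, ht.2]
  have h := hI.energy_le k ht
  simp only [gegenbauerEnergy, eval_add, eval_mul, eval_C, eval_sub, eval_one, eval_pow,
    eval_X] at h
  have : 0 ≤ (1 - t ^ 2) ^ N * ((k * (k + N) : ℝ) * ((gegenbauer N k).eval t *
      (gegenbauer N k).eval t)) :=
    mul_nonneg (pow_nonneg hw _) (mul_nonneg (by positivity) (mul_self_nonneg _))
  rw [pow_succ]
  linarith

theorem abs_eval_le (hI : IsGegenbauerFunctional N I) (k : ℕ) {t : ℝ} (ht : |t| < 1) :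
    |(gegenbauer N k).eval t| ≤
      √(2 / (1 - t ^ 2) ^ N) * √(I (gegenbauer N k * gegenbauer N k)) := by
  have ht' := abs_lt.1 ht
  have hw : 0 < 1 - t ^ 2 := by nlinarith
  rw [← Real.sqrt_mul (by positivity)]
  refine Real.abs_le_sqrt ?_
  rw [div_mul_eq_mul_div, le_div_iff₀ (by positivity), mul_comm]
  exact hI.eval_sq_le k ⟨ht'.1.le, ht'.2.le⟩

/-- With `x = (k + 1)|t|`, the triangle inequality gives a factor `2` and the mean value inequality
a factor `x`; both are at most `2 x^α` on their side of `x = 1`. -/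
theorem abs_eval_sub_le (hI : IsGegenbauerFunctional N I) (k : ℕ) {t : ℝ} (ht : |t| ≤ 1 / 2)
    {α : ℝ} (hα : 0 ≤ α) (hα1 : α ≤ 1) :
    |(gegenbauer N k).eval 0 - (gegenbauer N k).eval t| ≤
      2 * √((N + 1) * 2 ^ (N + 2)) * √(I (gegenbauer N k * gegenbauer N k)) *
        ((k + 1) * |t|) ^ α := by
  set h := I (gegenbauer N k * gegenbauer N k) with hh
  -- One constant for both bounds on `|s| ≤ 1/2`, where `1 - s² ≥ 1/2`: it exceeds `2 · 2^N`, needed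
  -- for `φ_k²`, and `(k + 1)² D` exceeds `2^(N+2) k (k + N)`, needed for `φ_k'²`.
  set D : ℝ := (N + 1) * 2 ^ (N + 2) with hD
  have h0 : 0 ≤ h := hI.nonneg _ fun t _ => by simpa using mul_self_nonneg _
  have hw : ∀ s : ℝ, |s| ≤ 1 / 2 → ∀ m : ℕ, (1 / 2 : ℝ) ^ m ≤ (1 - s ^ 2) ^ m := fun s hs m => by
    have := abs_le.1 hs
    exact pow_le_pow_left₀ (by norm_num) (by nlinarith) m
  have hmem : ∀ s : ℝ, |s| ≤ 1 / 2 → s ∈ Icc (-1 : ℝ) 1 := fun s hs => by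
    have := abs_le.1 hs
    constructor <;> linarith
  have conv : ∀ (m : ℕ) (x y : ℝ), (1 / 2 : ℝ) ^ m * x ≤ y → x ≤ 2 ^ m * y := fun m x y hxy => by
    have : (2 : ℝ) ^ m * ((1 / 2 : ℝ) ^ m * x) ≤ 2 ^ m * y := by gcongr
    rwa [← mul_assoc, ← mul_pow, mul_one_div_cancel two_ne_zero, one_pow, one_mul] at this
  have hv : ∀ s : ℝ, |s| ≤ 1 / 2 → |(gegenbauer N k).eval s| ≤ √D * √h := fun s hs => by
    rw [← Real.sqrt_mul (by positivity)]
    refine Real.abs_le_sqrt ?_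
    have h1 := conv N _ _ ((mul_le_mul_of_nonneg_right (hw s hs N) (sq_nonneg _)).trans
      (hI.eval_sq_le k (hmem s hs)))
    refine h1.trans ?_
    rw [← hh, hD, ← mul_assoc]
    refine mul_le_mul_of_nonneg_right ?_ h0
    have : (0 : ℝ) < 2 ^ N := by positivity
    have : (0 : ℝ) ≤ N * 2 ^ N := by positivity
    rw [pow_add]
    nlinarith
  have hdv : ∀ s : ℝ, |s| ≤ 1 / 2 → |(derivative (gegenbauer N k)).eval s| ≤
      (k + 1) * (√D * √h) := fun s hs => by
    have e : (k + 1 : ℝ) * (√D * √h) = √((k + 1) ^ 2 * (D * h)) := by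
      rw [Real.sqrt_mul (sq_nonneg ((k : ℝ) + 1)), Real.sqrt_sq (by positivity),
        Real.sqrt_mul (by positivity : 0 ≤ D)]
    rw [e]
    refine Real.abs_le_sqrt ?_
    have h1 := conv (N + 1) _ _ ((mul_le_mul_of_nonneg_right (hw s hs (N + 1)) (sq_nonneg _)).trans
      (hI.eval_derivative_sq_le k (hmem s hs)))
    refine h1.trans ?_
    rw [← hh, hD]
    have h2 : (k * (k + N) : ℝ) ≤ (k + 1) ^ 2 * (N + 1) := by
      have : (0 : ℝ) ≤ k := by positivity
      have : (0 : ℝ) ≤ N := by positivity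
      have : (0 : ℝ) ≤ k * N := by positivity
      have : (0 : ℝ) ≤ k * (k * N) := by positivity
      nlinarith
    calc (2 : ℝ) ^ (N + 1) * (2 * (k * (k + N)) * h) = 2 ^ (N + 2) * h * (k * (k + N)) := by ring
      _ ≤ 2 ^ (N + 2) * h * ((k + 1) ^ 2 * (N + 1)) := by gcongr
      _ = _ := by ring
  have hP : 0 ≤ √D * √h := by positivity
  have b1 : |(gegenbauer N k).eval 0 - (gegenbauer N k).eval t| ≤ 2 * (√D * √h) := by
    have := hv 0 (by norm_num)
    have := hv t ht
    exact (abs_sub _ _).trans (by linarith)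
  have b2 : |(gegenbauer N k).eval 0 - (gegenbauer N k).eval t| ≤ (k + 1) * (√D * √h) * |t| := by
    have := (convex_closedBall (0 : ℝ) (1 / 2)).norm_image_sub_le_of_norm_deriv_le
      (f := fun t => (gegenbauer N k).eval t) (C := (k + 1) * (√D * √h)) (x := t) (y := 0)
      (fun x _ => by fun_prop) (fun x hx => ?_) (by simpa using ht) (by simp)
    · simpa [Real.norm_eq_abs] using this
    · rw [Polynomial.deriv]
      exact hdv x (by simpa using hx)
  have hx : 0 ≤ (k + 1) * |t| := by positivity
  rcases le_total 1 ((k + 1) * |t|) with h1 | h1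
  · have := Real.one_le_rpow h1 hα
    nlinarith
  · have := Real.rpow_le_rpow_of_exponent_ge' hx h1 hα hα1
    rw [Real.rpow_one] at this
    nlinarith [mul_le_mul_of_nonneg_left this hP, mul_nonneg hP hx]

end IsGegenbauerFunctional

end GegenbauerFunctional

/-! ### Moments of the uniform measure and integration by parts on the sphere. -/

section Moments

open Polynomial

variable {E : Type*} [NormedAddCommGroup E] [InnerProductSpace ℝ E] [FiniteDimensional ℝ E]
  [MeasurableSpace E] [BorelSpace E]

theorem integral_uniformSphere_reflection {F : Type*} [NormedAddCommGroup F] [NormedSpace ℝ F]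
    (g : E → F) (v : E) :
    ∫ x : sphere (0 : E) 1, g ((ℝ ∙ v)ᗮ.reflection x) ∂uniformSphere E =
      ∫ x : sphere (0 : E) 1, g x ∂uniformSphere E := by
  rw [← sphere_emb.integral_map (g := g),
    ← sphere_emb.integral_map (g := fun x => g ((ℝ ∙ v)ᗮ.reflection x))]
  conv_rhs => rw [← map_uniformSphere_refl v]
  exact ((ℝ ∙ v)ᗮ.reflection.toHomeomorph.measurableEmbedding.integral_map g).symm

/-- Vectors of equal norm are exchanged by the reflection in the hyperplane orthogonal to their
difference. -/
theorem integral_inner_eq_of_norm {F : Type*} [NormedAddCommGroup F] [NormedSpace ℝ F]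
    (g : ℝ → F) {v w : E} (h : ‖v‖ = ‖w‖) :
    ∫ x : sphere (0 : E) 1, g (inner ℝ (x : E) v) ∂uniformSphere E =
      ∫ x : sphere (0 : E) 1, g (inner ℝ (x : E) w) ∂uniformSphere E := by
  rw [← integral_uniformSphere_reflection (fun x => g (inner ℝ x v)) (v - w)]
  congr with x
  congr 1
  rw [← LinearIsometryEquiv.inner_map_map (ℝ ∙ (v - w))ᗮ.reflection,
    Submodule.reflection_reflection, Submodule.reflection_sub h]

theorem continuous_integrable [Nontrivial E] {F : Type*} [NormedAddCommGroup F]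
    {f : sphere (0 : E) 1 → F} (hf : Continuous f) : Integrable f (uniformSphere E) :=
  hf.integrable_of_hasCompactSupport (HasCompactSupport.of_compactSpace f)

/-- The moment functions of the uniform measure are multiples of powers of the norm. -/
theorem exists_integral_inner_pow [Nontrivial E] (m : ℕ) :
    ∃ c : ℝ, ∀ v : E, ∫ x : sphere (0 : E) 1, inner ℝ (x : E) v ^ m ∂uniformSphere E =
      c * ‖v‖ ^ m := by
  obtain ⟨e, he⟩ := exists_norm_eq E zero_le_one
  refine ⟨∫ x : sphere (0 : E) 1, inner ℝ (x : E) e ^ m ∂uniformSphere E, fun v => ?_⟩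
  rw [integral_inner_eq_of_norm (fun t => t ^ m) (show ‖v‖ = ‖‖v‖ • e‖ by simp [norm_smul, he]),
    mul_comm, ← integral_const_mul]
  congr with x
  rw [inner_smul_right, mul_pow]

theorem integral_inner_pow_odd (l : ℕ) (v : E) :
    ∫ x : sphere (0 : E) 1, inner ℝ (x : E) v ^ (2 * l + 1) ∂uniformSphere E = 0 := by
  have h := integral_inner_eq_of_norm (fun t => t ^ (2 * l + 1)) (norm_neg v)
  simp only [inner_neg_right, Odd.neg_pow ⟨l, rfl⟩, integral_neg] at h
  linarith

/-- Second order comparison of the moments in the directions `w` and `w + ε v`, `v ⟂ w`. -/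
theorem integral_inner_pow_mul_sq [Nontrivial E] (l : ℕ) {v w : E} (hvw : inner ℝ w v = 0)
    (hv : ‖v‖ = 1) :
    (2 * l + 1) * (‖w‖ ^ 2 * ∫ x : sphere (0 : E) 1,
      inner ℝ (x : E) w ^ (2 * l) * inner ℝ (x : E) v ^ 2 ∂uniformSphere E) =
      ∫ x : sphere (0 : E) 1, inner ℝ (x : E) w ^ (2 * (l + 1)) ∂uniformSphere E := by
  obtain ⟨c, hc⟩ := exists_integral_inner_pow (E := E) (2 * (l + 1))
  set m := 2 * (l + 1) with hm
  -- `P` and `Q` are the two sides of `∫ ⟪x, w + ε v⟫^m = c (‖w‖² + ε²)^(l+1)` as polynomials in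
  -- `ε`. The claim is the equality of their coefficients of `ε²`.
  set P : ℝ[X] := ∑ i ∈ Finset.range (m + 1), C (m.choose i *
    ∫ x : sphere (0 : E) 1, inner ℝ (x : E) w ^ (m - i) * inner ℝ (x : E) v ^ i
      ∂uniformSphere E) * X ^ i with hP
  set Q : ℝ[X] := C c * (C (‖w‖ ^ 2) + X ^ 2) ^ (l + 1) with hQ
  have hPQ : P = Q := by
    refine Polynomial.funext fun ε => ?_
    have h1 : ‖w + ε • v‖ ^ 2 = ‖w‖ ^ 2 + ε ^ 2 := by
      rw [norm_add_sq_real, inner_smul_right, hvw, norm_smul, hv]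
      simp
    have h2 := hc (w + ε • v)
    rw [pow_mul ‖_‖, h1] at h2
    simp only [hQ, eval_mul, eval_C, eval_pow, eval_add, eval_X]
    rw [← h2, hP, eval_finsetSum]
    have h3 : ∀ x : sphere (0 : E) 1, inner ℝ (x : E) (w + ε • v) ^ m =
        ∑ i ∈ Finset.range (m + 1), (m.choose i * ε ^ i) *
          (inner ℝ (x : E) w ^ (m - i) * inner ℝ (x : E) v ^ i) := fun x => by
      rw [inner_add_right, inner_smul_right, add_comm, add_pow]
      refine Finset.sum_congr rfl fun i _ => ?_
      rw [mul_pow]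
      ring
    simp only [h3]
    rw [integral_finsetSum _ fun i _ => continuous_integrable (by fun_prop)]
    refine Finset.sum_congr rfl fun i _ => ?_
    rw [integral_const_mul]
    simp
    ring
  have h2 := congrArg (fun p => coeff p 2) hPQ
  have hP2 : P.coeff 2 = m.choose 2 * ∫ x : sphere (0 : E) 1,
      inner ℝ (x : E) w ^ (2 * l) * inner ℝ (x : E) v ^ 2 ∂uniformSphere E := by
    rw [hP, finsetSum_coeff, Finset.sum_eq_single 2]
    · rw [coeff_C_mul, coeff_X_pow_self, mul_one]
      rfl
    · intro i _ hi
      rw [coeff_C_mul, coeff_X_pow, if_neg hi.symm, mul_zero]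
    · intro h
      exact absurd (Finset.mem_range.2 (by omega)) h
  have hQ2 : Q.coeff 2 = c * ((l + 1) * (‖w‖ ^ 2) ^ l) := by
    have : (C (‖w‖ ^ 2) + X ^ 2 : ℝ[X]) ^ (l + 1) =
        expand ℝ 2 ((X + C (‖w‖ ^ 2)) ^ (l + 1)) := by
      simp [add_comm]
    rw [hQ, coeff_C_mul, this, show (2 : ℕ) = 1 * 2 by rfl, coeff_expand_mul (by norm_num),
      coeff_X_add_C_pow]
    simp [mul_comm]
  simp only [hP2, hQ2] at h2
  rw [hc w]
  have h3 : (m.choose 2 : ℝ) = (l + 1) * (2 * l + 1) := by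
    rw [Nat.cast_choose_two, hm]
    push_cast
    ring
  rw [h3] at h2
  have h4 : (l + 1 : ℝ) ≠ 0 := by positivity
  refine mul_left_cancel₀ h4 ?_
  rw [hm, pow_mul]
  linear_combination ‖w‖ ^ 2 * h2

/-- Pythagoras for the component of `x` orthogonal to `w`; the factor `‖w‖ ^ 2` avoids a division
and admits `w = 0`. -/
theorem sum_inner_orthonormalBasis_sq {w : E} {ι : Type*} [Fintype ι]
    (b : OrthonormalBasis ι ℝ (ℝ ∙ w)ᗮ) (x : E) :
    ‖w‖ ^ 2 * ∑ i, inner ℝ x (b i : E) ^ 2 = ‖w‖ ^ 2 * ‖x‖ ^ 2 - inner ℝ x w ^ 2 := by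
  have h1 : ∀ i, inner ℝ x (b i : E) =
      inner ℝ ((ℝ ∙ w)ᗮ.orthogonalProjectionOnto x) (b i) := fun i => by
    rw [Submodule.inner_orthogonalProjectionOnto_eq_of_mem_right]
  simp only [h1]
  have h2 : ∑ i, inner ℝ ((ℝ ∙ w)ᗮ.orthogonalProjectionOnto x) (b i) ^ 2 =
      ‖(ℝ ∙ w)ᗮ.orthogonalProjectionOnto x‖ ^ 2 := by
    rw [← b.sum_sq_norm_inner_left]
    simp
  rw [h2]
  rcases eq_or_ne w 0 with rfl | hw
  · simp
  have h3 := (ℝ ∙ w).norm_sq_eq_add_norm_sq_projection x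
  have h4 : ‖w‖ ^ 2 * ‖(ℝ ∙ w).orthogonalProjectionOnto x‖ ^ 2 = inner ℝ x w ^ 2 := by
    rw [Submodule.coe_norm, Submodule.coe_orthogonalProjectionOnto_apply,
      Submodule.starProjection_singleton, norm_smul, mul_pow, real_inner_comm]
    have : ‖w‖ ≠ 0 := norm_ne_zero_iff.2 hw
    simp
    field_simp
    exact sq_abs _
  linear_combination -‖w‖ ^ 2 * h3 - h4

/-- Integration by parts on the sphere, for powers. -/
theorem integral_inner_pow_succ (hE : 1 ≤ Module.finrank ℝ E) (j : ℕ) (w : E) :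
    (j + 1) * (‖w‖ ^ 2 * ∫ x : sphere (0 : E) 1, inner ℝ (x : E) w ^ j ∂uniformSphere E) =
      (Module.finrank ℝ E + j) *
        ∫ x : sphere (0 : E) 1, inner ℝ (x : E) w ^ (j + 2) ∂uniformSphere E := by
  have : Nontrivial E := Module.nontrivial_of_finrank_pos (R := ℝ) (by omega)
  rcases Nat.even_or_odd' j with ⟨l, rfl | rfl⟩
  · rcases eq_or_ne w 0 with rfl | hw
    · simp
    -- Summing the second order identity over an orthonormal basis of `wᗮ` turns the squares `⟪x, b
    -- i⟫²` into `1 - ⟪x, w⟫² / ‖w‖²`, and the number of summands brings in the dimension.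
    set b := stdOrthonormalBasis ℝ (ℝ ∙ w)ᗮ
    have hb : ∀ i, inner ℝ w (b i : E) = 0 := fun i =>
      Submodule.mem_orthogonal_singleton_iff_inner_right.1 (b i).2
    have hb1 : ∀ i, ‖(b i : E)‖ = 1 := fun i => by
      rw [← Submodule.coe_norm]
      exact b.orthonormal.1 i
    have h := fun i => integral_inner_pow_mul_sq l (hb i) (hb1 i)
    have hs := Finset.sum_congr rfl fun i (_ : i ∈ Finset.univ) => h i
    rw [← Finset.mul_sum, ← Finset.mul_sum, ← integral_finsetSum _ fun i _ =>
      continuous_integrable (by fun_prop), ← integral_const_mul] at hs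
    have hdim := Submodule.finrank_add_finrank_orthogonal (ℝ ∙ w)
    rw [finrank_span_singleton hw] at hdim
    have h2 : ∀ x : sphere (0 : E) 1, ‖w‖ ^ 2 * ∑ i, inner ℝ (x : E) w ^ (2 * l) *
        inner ℝ (x : E) (b i : E) ^ 2 =
        ‖w‖ ^ 2 * inner ℝ (x : E) w ^ (2 * l) - inner ℝ (x : E) w ^ (2 * l + 2) := fun x => by
      rw [← Finset.mul_sum]
      have h3 := sum_inner_orthonormalBasis_sq b (x : E)
      simp only [norm_eq_of_mem_sphere] at h3
      linear_combination inner ℝ (x : E) w ^ (2 * l) * h3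
    simp only [h2] at hs
    rw [integral_sub (continuous_integrable (by fun_prop)) (continuous_integrable (by fun_prop)),
      integral_const_mul] at hs
    simp only [Finset.sum_const, Finset.card_univ, Fintype.card_fin, nsmul_eq_mul] at hs
    have h5 : (Module.finrank ℝ E : ℝ) = 1 + Module.finrank ℝ (ℝ ∙ w)ᗮ := by
      exact_mod_cast hdim.symm
    rw [h5]
    push_cast
    rw [show 2 * (l + 1) = 2 * l + 2 by ring] at hs
    linear_combination hs
  · rw [show 2 * l + 1 + 2 = 2 * (l + 1) + 1 by ring, integral_inner_pow_odd,
      integral_inner_pow_odd]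
    simp

/-- The functional `p ↦ ∫ p(⟪x, w⟫) dσ(x)`. -/
noncomputable def zonalFunctional [Nontrivial E] (w : E) : ℝ[X] →ₗ[ℝ] ℝ where
  toFun p := ∫ x : sphere (0 : E) 1, p.eval (inner ℝ (x : E) w) ∂uniformSphere E
  map_add' p q := by
    simp only [eval_add]
    exact integral_add (continuous_integrable (by fun_prop)) (continuous_integrable (by fun_prop))
  map_smul' r p := by
    simp only [eval_smul, smul_eq_mul, RingHom.id_apply]
    exact integral_const_mul _ _

theorem zonalFunctional_apply [Nontrivial E] (w : E) (p : ℝ[X]) : zonalFunctional w p =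
    ∫ x : sphere (0 : E) 1, p.eval (inner ℝ (x : E) w) ∂uniformSphere E := rfl

theorem zonalFunctional_one [Nontrivial E] (w : E) : zonalFunctional w 1 = 1 := by
  simp [zonalFunctional_apply]

/-- On monomials this is the recurrence of the moments. Vectors `w` of any norm are needed, since on
slices `w` is the projection of a unit vector to a hyperplane. -/
theorem zonalFunctional_by_parts [Nontrivial E] {N : ℕ} (hE : Module.finrank ℝ E = N + 1) (w : E)
    (p : ℝ[X]) : zonalFunctional w ((C (‖w‖ ^ 2) - X ^ 2) * derivative p) =
      zonalFunctional w (C (N : ℝ) * (X * p)) := by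
  induction p using Polynomial.induction_on' with
  | add p q hp hq => simp only [mul_add, map_add, hp, hq]
  | monomial j a =>
    rw [← C_mul_X_pow_eq_monomial]
    rcases j with _ | j
    · have h := integral_inner_pow_odd (E := E) 0 w
      simp [mul_left_comm, zonalFunctional_apply] at h ⊢
      simp [integral_const_mul, h]
    · have h := integral_inner_pow_succ (by omega : 1 ≤ Module.finrank ℝ E) j w
      have e1 : (C (‖w‖ ^ 2) - X ^ 2) * derivative (C a * X ^ (j + 1)) =
          C (a * (j + 1)) * (C (‖w‖ ^ 2) * X ^ j - X ^ (j + 2)) := by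
        simp only [derivative_C_mul, derivative_X_pow_succ, C_mul, C_add, map_natCast, C_1]
        ring
      have e2 : C (N : ℝ) * (X * (C a * X ^ (j + 1))) = C (N * a) * X ^ (j + 2) := by
        simp only [C_mul, map_natCast]
        ring
      rw [e1, e2, map_C_mul, map_C_mul, map_sub, map_C_mul]
      simp only [zonalFunctional_apply, eval_pow, eval_X]
      rw [hE] at h
      push_cast at h
      linear_combination a * h

theorem isGegenbauerFunctional_zonalFunctional [Nontrivial E] {N : ℕ}
    (hE : Module.finrank ℝ E = N + 2) {e : E} (he : ‖e‖ = 1) :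
    IsGegenbauerFunctional N (zonalFunctional e) where
  map_one := zonalFunctional_one e
  by_parts p := by simpa [he] using zonalFunctional_by_parts (N := N + 1) hE e p
  nonneg p hp := integral_nonneg fun x => hp _ <| by
    have := abs_real_inner_le_norm (x : E) e
    rw [he, norm_eq_of_mem_sphere, one_mul] at this
    exact abs_le.1 this

end Moments

/-! ### Slice averages of zonal functions and the reproducing formula. -/

section Zonal

open Polynomial

variable {E : Type*} [NormedAddCommGroup E] [InnerProductSpace ℝ E] [FiniteDimensional ℝ E]
  [MeasurableSpace E] [BorelSpace E]

/-- For `z = δ x + r u` in the slice, `⟪z, y⟫ = δ s + r ⟪u, w⟫` with `w` the projection of `y` to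
`xᗮ`. Integration by parts on the sphere of `xᗮ` is then the hypothesis of the product formula at `a
= δ`, `c = s`, because `(1 - δ²)(1 - s²) - (t - δ s)² = r² (‖w‖² - ⟪u, w⟫²)` for `t = ⟪z, y⟫`. -/
theorem integral_slice_gegenbauer {N : ℕ} (hE : Module.finrank ℝ E = N + 2) (hN : 1 ≤ N)
    (δ : Icc (-1 : ℝ) 1) (x y : sphere (0 : E) 1) (k : ℕ) :
    ∫ z, (gegenbauer N k).eval (inner ℝ (z : E) y) ∂sliceMeasure δ x =
      (gegenbauer N k).eval (δ : ℝ) * (gegenbauer N k).eval (inner ℝ (x : E) y) := by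
  have := nontrivial_orth (by omega) (x : E)
  have hx : ‖(x : E)‖ = 1 := norm_eq_of_mem_sphere x
  have hy : ‖(y : E)‖ = 1 := norm_eq_of_mem_sphere y
  set s : ℝ := inner ℝ (x : E) y with hs
  set w := (ℝ ∙ (x : E))ᗮ.orthogonalProjectionOnto (y : E) with hw
  set r := √(1 - (δ : ℝ) ^ 2) with hr
  have hr2 : r ^ 2 = 1 - (δ : ℝ) ^ 2 := by
    have := δ.2.1
    have := δ.2.2
    exact Real.sq_sqrt (by nlinarith)
  have hw2 : ‖w‖ ^ 2 = 1 - s ^ 2 := by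
    rw [Submodule.coe_norm, proj_val _ hx, norm_sub_sq_real, inner_smul_right, norm_smul, hx, hy,
      real_inner_comm (x : E) (y : E), ← hs]
    simp
    ring
  have hdim : Module.finrank ℝ (ℝ ∙ (x : E))ᗮ = N + 1 := by
    have := Submodule.finrank_add_finrank_orthogonal (ℝ ∙ (x : E))
    rw [finrank_span_singleton (norm_ne_zero_iff.1 (by rw [hx]; exact one_ne_zero))] at this
    omega
  set L : ℝ[X] := C (δ * s) + C r * X with hL
  set l : ℝ[X] →ₗ[ℝ] ℝ := zonalFunctional w ∘ₗ (aeval L).toLinearMap with hl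
  have hlp : ∀ p : ℝ[X], l p = zonalFunctional w (p.comp L) := fun p => by
    simp [hl, aeval_def, comp, eval₂_eq_sum]
  have h1 : ∫ z, (gegenbauer N k).eval (inner ℝ (z : E) y) ∂sliceMeasure δ x =
      l (gegenbauer N k) := by
    rw [hlp, zonalFunctional_apply, sliceMeasure,
      integral_map (continuous_sliceEmb δ x).aemeasurable
        (Continuous.aestronglyMeasurable (by fun_prop))]
    congr with u
    rw [eval_comp]
    congr 1
    simp only [sliceEmb, inner_add_left, inner_smul_left, hL, eval_add, eval_mul, eval_C, eval_X]
    rw [hw, Submodule.inner_orthogonalProjectionOnto_eq_of_mem_left]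
    rfl
  rw [h1]
  refine gegenbauer_product N hN l δ s ?_ (fun p => ?_) k
  · rw [hlp, one_comp, zonalFunctional_one]
  · have h := zonalFunctional_by_parts hdim w (p.comp L)
    have hdL : derivative L = C r := by simp [hL]
    rw [derivative_comp, hdL] at h
    have e1 : (((C (1 - (δ : ℝ) ^ 2 - s ^ 2) - X ^ 2 + C (2 * δ * s) * X) * derivative p).comp L) =
        C r * ((C (‖w‖ ^ 2) - X ^ 2) * (C r * (derivative p).comp L)) := by
      have e3 : C (1 - (δ : ℝ) ^ 2) = (C r) ^ 2 := by rw [← C_pow, hr2]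
      have e4 : (C r : ℝ[X]) ^ 2 = 1 - C (δ : ℝ) ^ 2 := by rw [← C_pow, hr2]; simp
      simp only [mul_comp, add_comp, sub_comp, C_comp, X_comp, pow_comp, hw2, hL]
      simp only [C_sub, C_mul, C_pow, C_1, C_ofNat]
      linear_combination (-(1 - C s ^ 2) * (derivative p).comp (C (δ : ℝ) * C s + C r * X)) * e4
    have e2 : ((C (N : ℝ) * (X - C ((δ : ℝ) * s)) * p).comp L) =
        C r * (C (N : ℝ) * (X * p.comp L)) := by
      simp only [mul_comp, sub_comp, C_comp, X_comp, hL]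
      ring
    rw [hlp, hlp, e1, e2, map_C_mul, map_C_mul _ r, h]

theorem ae_inner_slice (δ : Icc (-1 : ℝ) 1) (x : sphere (0 : E) 1) :
    ∀ᵐ z : sphere (0 : E) 1 ∂sliceMeasure δ x, inner ℝ (x : E) (z : E) = δ := by
  rw [sliceMeasure, ae_map_iff (continuous_sliceEmb δ x).aemeasurable
    (measurableSet_eq_fun (by fun_prop) (by fun_prop))]
  exact .of_forall fun u => inner_sliceEmb δ x u

theorem inner_mem_Icc (x y : sphere (0 : E) 1) : inner ℝ (x : E) (y : E) ∈ Icc (-1 : ℝ) 1 := by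
  have h := abs_real_inner_le_norm (x : E) y
  rw [norm_eq_of_mem_sphere, norm_eq_of_mem_sphere, one_mul] at h
  exact abs_le.1 h

/-- The reflection exchanging `y` and `z` fixes `w`. -/
theorem integral_inner_mul_inner_eq (f g : ℝ → ℝ) {y z w : sphere (0 : E) 1}
    (h : inner ℝ (w : E) (y : E) = inner ℝ (w : E) (z : E)) :
    ∫ x : sphere (0 : E) 1, f (inner ℝ (x : E) y) * g (inner ℝ (x : E) w) ∂uniformSphere E =
      ∫ x : sphere (0 : E) 1, f (inner ℝ (x : E) z) * g (inner ℝ (x : E) w) ∂uniformSphere E := by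
  set R := (ℝ ∙ ((y : E) - z))ᗮ.reflection with hR
  have hy : R y = z := Submodule.reflection_sub (by simp)
  have hw : R w = w := by
    rw [refl_apply, real_inner_comm, inner_sub_right, h]
    simp
  rw [← integral_uniformSphere_reflection
    (fun x => f (inner ℝ x (z : E)) * g (inner ℝ x (w : E))) ((y : E) - z), ← hR]
  congr with x
  have h1 : inner ℝ (R x) (z : E) = inner ℝ (x : E) y := by
    rw [← hy, LinearIsometryEquiv.inner_map_map]
  have h2 : inner ℝ (R x) (w : E) = inner ℝ (x : E) w := by
    conv_lhs => rw [← hw, LinearIsometryEquiv.inner_map_map]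
  rw [h1, h2]

theorem zonalFunctional_eq_of_norm [Nontrivial E] {v w : E} (h : ‖v‖ = ‖w‖) :
    zonalFunctional v = zonalFunctional w :=
  LinearMap.ext fun p => integral_inner_eq_of_norm (fun t => p.eval t) h

/-- The reproducing formula for the zonal functions `x ↦ φ_k(⟪x, y⟫)`. -/
theorem integral_gegenbauer_mul [Nontrivial E] {N : ℕ} (hE : Module.finrank ℝ E = N + 2)
    (hN : 1 ≤ N) (e : sphere (0 : E) 1) (y w : sphere (0 : E) 1) (k j : ℕ) :
    ∫ x : sphere (0 : E) 1, (gegenbauer N k).eval (inner ℝ (x : E) y) *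
      (gegenbauer N j).eval (inner ℝ (x : E) w) ∂uniformSphere E =
      (gegenbauer N k).eval (inner ℝ (y : E) w) *
        zonalFunctional (e : E) (gegenbauer N k * gegenbauer N j) := by
  set F : sphere (0 : E) 1 → ℝ := fun z => ∫ x : sphere (0 : E) 1,
    (gegenbauer N k).eval (inner ℝ (x : E) z) * (gegenbauer N j).eval (inner ℝ (x : E) w)
      ∂uniformSphere E with hF
  -- `F` is constant on the slice around `w` that contains `y`, so `F y` is its average there. After
  -- exchanging the integrals, the slice average of the zonal function factors out `φ_k(δ)`.
  set δ : Icc (-1 : ℝ) 1 := ⟨inner ℝ (w : E) (y : E), inner_mem_Icc w y⟩ with hδ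
  have := isProb_slice (by omega) δ w
  have h1 : ∫ z, F z ∂sliceMeasure δ w = F y := by
    have : ∀ᵐ z ∂sliceMeasure δ w, F z = F y := by
      filter_upwards [ae_inner_slice δ w] with z hz
      exact integral_inner_mul_inner_eq (fun t => (gegenbauer N k).eval t)
        (fun t => (gegenbauer N j).eval t) hz
    rw [integral_congr_ae this]
    simp
  have h2 : ∫ z, F z ∂sliceMeasure δ w = (gegenbauer N k).eval (inner ℝ (y : E) w) *
      zonalFunctional (e : E) (gegenbauer N k * gegenbauer N j) := by
    rw [hF, integral_integral_swap (Continuous.integrable_of_hasCompactSupport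
      (by unfold Function.uncurry; fun_prop) (HasCompactSupport.of_compactSpace _))]
    have h3 : ∀ x : sphere (0 : E) 1, ∫ z, (gegenbauer N k).eval (inner ℝ (x : E) z) *
        (gegenbauer N j).eval (inner ℝ (x : E) w) ∂sliceMeasure δ w =
        (gegenbauer N k).eval (δ : ℝ) * (gegenbauer N k * gegenbauer N j).eval (inner ℝ (x : E) w) :=
      fun x => by
      rw [integral_mul_const]
      simp only [real_inner_comm _ (x : E)]
      rw [integral_slice_gegenbauer hE hN, eval_mul, mul_assoc]
    simp only [h3]
    rw [integral_const_mul, zonalFunctional_eq_of_norm (show ‖(e : E)‖ = ‖(w : E)‖ by simp),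
      zonalFunctional_apply, real_inner_comm]
  exact h1.symm.trans h2

end Zonal

/-! ### Functions on the sphere are determined by their moments. -/

section Density

open Polynomial

theorem span_gegenbauer (N : ℕ) :
    Submodule.span ℝ (range (gegenbauer N)) = ⊤ := by
  set S := Submodule.span ℝ (range (gegenbauer N)) with hS
  have hmem : ∀ k, gegenbauer N k ∈ S := fun k => Submodule.subset_span ⟨k, rfl⟩
  have hX : ∀ p ∈ S, X * p ∈ S := by
    intro p hp
    induction hp using Submodule.span_induction with
    | mem p hp =>
      obtain ⟨k, rfl⟩ := hp
      rcases k with _ | k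
      · simpa using hmem 1
      · have h : X * gegenbauer N (k + 1) = (2 * k + 2 + N : ℝ)⁻¹ •
            ((k + 1 + N : ℝ) • gegenbauer N (k + 2) + (k + 1 : ℝ) • gegenbauer N k) := by
          rw [eq_inv_smul_iff₀ (by positivity)]
          have := gegenbauer_recurrence N k
          simp only [smul_eq_C_mul, C_add, C_mul, map_natCast, C_1, C_ofNat]
          linear_combination -this
        rw [h]
        exact S.smul_mem _ (S.add_mem (S.smul_mem _ (hmem _)) (S.smul_mem _ (hmem _)))
    | zero => simp
    | add p q _ _ hp hq => rw [mul_add]; exact S.add_mem hp hq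
    | smul r p _ hp => rw [mul_smul_comm]; exact S.smul_mem _ hp
  have hpow : ∀ m : ℕ, (X : ℝ[X]) ^ m ∈ S := fun m => by
    induction m with
    | zero => simpa using hmem 0
    | succ m ih => rw [pow_succ']; exact hX _ ih
  refine eq_top_iff.2 fun p _ => ?_
  rw [p.as_sum_range_C_mul_X_pow]
  exact S.sum_mem fun m _ => by rw [← smul_eq_C_mul]; exact S.smul_mem _ (hpow m)

variable {E : Type*} [NormedAddCommGroup E] [InnerProductSpace ℝ E] [FiniteDimensional ℝ E]
  [MeasurableSpace E] [BorelSpace E]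

/-- Termwise integration of the exponential series, dominated by `‖v‖^m / m!` times the `L¹` norm of
`g`. -/
theorem integral_exp_inner_mul_eq_zero [Nontrivial E] {g : sphere (0 : E) 1 → ℝ}
    (hg : Integrable g (uniformSphere E))
    (h : ∀ (m : ℕ) (v : E), ∫ x : sphere (0 : E) 1, inner ℝ (x : E) v ^ m * g x
      ∂uniformSphere E = 0) (v : E) :
    ∫ x : sphere (0 : E) 1, (g x : ℂ) * Complex.exp (inner ℝ (x : E) v * Complex.I)
      ∂uniformSphere E = 0 := by
  set F : ℕ → sphere (0 : E) 1 → ℂ := fun m x =>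
    (Complex.I ^ m / m.factorial : ℂ) * ((inner ℝ (x : E) v ^ m * g x : ℝ) : ℂ) with hF
  have hb : ∀ (m : ℕ) (x : sphere (0 : E) 1), |inner ℝ (x : E) v ^ m| ≤ ‖v‖ ^ m := fun m x => by
    have := abs_real_inner_le_norm (x : E) v
    rw [norm_eq_of_mem_sphere, one_mul] at this
    rw [abs_pow]
    gcongr
  have hi : ∀ m, Integrable (fun x : sphere (0 : E) 1 => inner ℝ (x : E) v ^ m * g x)
      (uniformSphere E) := fun m =>
    hg.bdd_mul (c := ‖v‖ ^ m) (Continuous.aestronglyMeasurable (by fun_prop))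
      (.of_forall fun x => hb m x)
  have hFi : ∀ m, Integrable (F m) (uniformSphere E) := fun m => (hi m).ofReal.const_mul _
  have hsum : Summable fun m => ∫ x, ‖F m x‖ ∂uniformSphere E := by
    refine Summable.of_nonneg_of_le (fun m => integral_nonneg fun x => norm_nonneg _) (fun m => ?_)
      ((Real.summable_pow_div_factorial ‖v‖).mul_right (∫ x, ‖g x‖ ∂uniformSphere E))
    rw [← integral_const_mul]
    refine integral_mono (hFi m).norm (hg.norm.const_mul _) fun x => ?_
    simp only [hF, norm_mul, norm_div, norm_pow, Complex.norm_I, one_pow, Complex.norm_real,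
      Complex.norm_natCast, Real.norm_eq_abs]
    rw [← abs_pow, ← mul_assoc, one_div_mul_eq_div]
    gcongr
    exact hb m x
  have h1 := hasSum_integral_of_summable_integral_norm hFi hsum
  have h2 : ∀ m, ∫ x, F m x ∂uniformSphere E = 0 := fun m => by
    simp only [hF]
    rw [integral_const_mul, integral_complex_ofReal, h m v]
    simp
  simp only [h2] at h1
  rw [← h1.unique hasSum_zero]
  congr with x
  have h3 := (NormedSpace.expSeries_div_hasSum_exp ((inner ℝ (x : E) v : ℂ) * Complex.I)).mul_left
    (g x : ℂ)
  rw [← Complex.exp_eq_exp_ℂ] at h3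
  rw [← h3.tsum_eq]
  congr with m
  simp only [hF]
  push_cast
  ring

/-- The Fourier transform of `g σ` vanishes, so the finite measures with densities `g⁺` and `g⁻`
have the same characteristic function and coincide. Truncation by `ENNReal.ofReal` produces these
positive parts. -/
theorem ae_eq_zero_of_integral_pow [Nontrivial E] {g : sphere (0 : E) 1 → ℝ}
    (hg : Integrable g (uniformSphere E))
    (h : ∀ (m : ℕ) (v : E), ∫ x : sphere (0 : E) 1, inner ℝ (x : E) v ^ m * g x
      ∂uniformSphere E = 0) : g =ᵐ[uniformSphere E] 0 := by
  have key : ∀ (t : E) (u : sphere (0 : E) 1 → ℝ), Integrable u (uniformSphere E) →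
      charFun (((uniformSphere E).withDensity fun x => ENNReal.ofReal (u x)).map Subtype.val) t =
      ∫ x : sphere (0 : E) 1, ((max (u x) 0 : ℝ) : ℂ) * Complex.exp (inner ℝ (x : E) t * Complex.I)
        ∂uniformSphere E := fun t u hu => by
    rw [charFun_apply, sphere_emb.integral_map,
      integral_withDensity_eq_integral_toReal_smul₀
        hu.aestronglyMeasurable.aemeasurable.ennreal_ofReal (.of_forall fun x => ENNReal.ofReal_lt_top)]
    congr with x
  have hint : ∀ (t : E) (u : sphere (0 : E) 1 → ℝ), Integrable u (uniformSphere E) →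
      Integrable (fun x : sphere (0 : E) 1 => ((max (u x) 0 : ℝ) : ℂ) *
        Complex.exp (inner ℝ (x : E) t * Complex.I)) (uniformSphere E) := fun t u hu =>
    hu.pos_part.ofReal.mul_bdd (c := 1) (Continuous.aestronglyMeasurable (by fun_prop))
      (.of_forall fun x => (Complex.norm_exp_ofReal_mul_I _).le)
  have hfin : ∀ u : sphere (0 : E) 1 → ℝ, Integrable u (uniformSphere E) →
      IsFiniteMeasure ((uniformSphere E).withDensity fun x => ENNReal.ofReal (u x)) := fun u hu =>
    isFiniteMeasure_withDensity_ofReal hu.2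
  have := hfin g hg
  have := hfin (-g) hg.neg
  have h1 : ((uniformSphere E).withDensity fun x => ENNReal.ofReal (g x)).map Subtype.val =
      ((uniformSphere E).withDensity fun x => ENNReal.ofReal ((-g) x)).map
        (Subtype.val : sphere (0 : E) 1 → E) := by
    apply Measure.ext_of_charFun
    ext t
    rw [key t g hg, key t (-g) hg.neg, ← sub_eq_zero, ← integral_sub (hint t g hg)
      (hint t (-g) hg.neg), ← integral_exp_inner_mul_eq_zero hg h t]
    congr with x
    rw [← sub_mul, ← Complex.ofReal_sub]
    congr 2
    simp only [Pi.neg_apply]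
    rcases le_total 0 (g x) with h0 | h0
    · rw [max_eq_left h0, max_eq_right (by linarith), sub_zero]
    · rw [max_eq_right h0, max_eq_left (by linarith), zero_sub, neg_neg]
  have h2 := sphere_emb.map_injective h1
  rw [withDensity_eq_iff_of_sigmaFinite hg.aestronglyMeasurable.aemeasurable.ennreal_ofReal
    hg.neg.aestronglyMeasurable.aemeasurable.ennreal_ofReal] at h2
  filter_upwards [h2] with x hx
  simp only [Pi.neg_apply] at hx
  rcases lt_trichotomy (g x) 0 with h0 | h0 | h0
  · rw [ENNReal.ofReal_of_nonpos h0.le, eq_comm, ENNReal.ofReal_eq_zero] at hx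
    linarith
  · exact h0
  · rw [ENNReal.ofReal_of_nonpos (by linarith : -g x ≤ 0), ENNReal.ofReal_eq_zero] at hx
    linarith

end Density

/-! ### Spaces of harmonics: eigenvalues, multiplicities, completeness. -/

section Harmonic

open Polynomial

variable {E : Type*} [NormedAddCommGroup E] [InnerProductSpace ℝ E] [FiniteDimensional ℝ E]
  [MeasurableSpace E] [BorelSpace E]

theorem memLp_continuous [Nontrivial E] {f : sphere (0 : E) 1 → ℂ} (hf : Continuous f) :
    MemLp f 2 (uniformSphere E) :=
  hf.memLp_of_hasCompactSupport (HasCompactSupport.of_compactSpace f)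

/-- The zonal function `x ↦ φ_k(⟪x, y⟫)` as an element of `L²`. -/
noncomputable def zonal [Nontrivial E] (N k : ℕ) (y : sphere (0 : E) 1) :
    Lp ℂ 2 (uniformSphere E) :=
  (memLp_continuous (f := fun x : sphere (0 : E) 1 =>
    (((gegenbauer N k).eval (inner ℝ (x : E) y) : ℝ) : ℂ)) (by fun_prop)).toLp _

/-- The space spanned by the zonal functions of degree `k`. -/
noncomputable def harmonicSpace (E : Type*) [NormedAddCommGroup E] [InnerProductSpace ℝ E]
    [FiniteDimensional ℝ E] [MeasurableSpace E] [BorelSpace E] [Nontrivial E] (N k : ℕ) :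
    Submodule ℂ (Lp ℂ 2 (uniformSphere E)) :=
  Submodule.span ℂ (range (zonal N k))

variable [Nontrivial E] {N : ℕ}

theorem coeFn_zonal (k : ℕ) (y : sphere (0 : E) 1) : zonal N k y =ᵐ[uniformSphere E]
    fun x : sphere (0 : E) 1 => (((gegenbauer N k).eval (inner ℝ (x : E) y) : ℝ) : ℂ) :=
  MemLp.coeFn_toLp _

theorem inner_zonal (k : ℕ) (y : sphere (0 : E) 1) (f : Lp ℂ 2 (uniformSphere E)) :
    inner ℂ (zonal N k y) f = ∫ x : sphere (0 : E) 1,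
      (((gegenbauer N k).eval (inner ℝ (x : E) y) : ℝ) : ℂ) * f x ∂uniformSphere E := by
  rw [L2.inner_def]
  refine integral_congr_ae ?_
  filter_upwards [coeFn_zonal (N := N) k y] with x hx
  rw [hx, RCLike.inner_apply, Complex.conj_ofReal, mul_comm]

theorem inner_zonal_zonal (hE : Module.finrank ℝ E = N + 2) (hN : 1 ≤ N) (e : sphere (0 : E) 1)
    (k j : ℕ) (y w : sphere (0 : E) 1) :
    inner ℂ (zonal N k y) (zonal N j w) = (((gegenbauer N k).eval (inner ℝ (y : E) w) *
      zonalFunctional (e : E) (gegenbauer N k * gegenbauer N j) : ℝ) : ℂ) := by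
  rw [inner_zonal, ← integral_gegenbauer_mul hE hN e y w k j, ← integral_complex_ofReal]
  refine integral_congr_ae ?_
  filter_upwards [coeFn_zonal (N := N) j w] with x hx
  rw [hx, Complex.ofReal_mul]

theorem sphereAverage_zonal (hE : Module.finrank ℝ E = N + 2) (hN : 1 ≤ N)
    (hE' : 2 ≤ Module.finrank ℝ E) (δ : Icc (-1 : ℝ) 1) (k : ℕ) (y : sphere (0 : E) 1) :
    sphereAverage hE' δ (zonal N k y) = (((gegenbauer N k).eval (δ : ℝ) : ℝ) : ℂ) •
      zonal N k y := by
  apply Lp.ext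
  filter_upwards [coeFn_sphereAverage hE' δ (zonal N k y),
    ae_slice hE' δ (coeFn_zonal (N := N) k y),
    coeFn_zonal (N := N) k y, Lp.coeFn_smul (((gegenbauer N k).eval (δ : ℝ) : ℝ) : ℂ)
      (zonal N k y)] with x h1 h2 h3 h4
  rw [h1, h4, Pi.smul_apply, h3, integral_congr_ae h2, integral_complex_ofReal,
    integral_slice_gegenbauer hE hN, Complex.ofReal_mul, smul_eq_mul]

theorem sphereAverage_harmonic (hE : Module.finrank ℝ E = N + 2) (hN : 1 ≤ N)
    (hE' : 2 ≤ Module.finrank ℝ E) (δ : Icc (-1 : ℝ) 1) (k : ℕ) {f : Lp ℂ 2 (uniformSphere E)}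
    (hf : f ∈ harmonicSpace E N k) :
    sphereAverage hE' δ f = (((gegenbauer N k).eval (δ : ℝ) : ℝ) : ℂ) • f := by
  induction hf using Submodule.span_induction with
  | mem f hf =>
    obtain ⟨y, rfl⟩ := hf
    exact sphereAverage_zonal hE hN hE' δ k y
  | zero => simp
  | add f g _ _ hf hg => rw [map_add, hf, hg, smul_add]
  | smul r f _ hf => rw [map_smul, hf, smul_comm]

theorem orthogonal_harmonicSpace (hE : Module.finrank ℝ E = N + 2) (hN : 1 ≤ N) {j k : ℕ}
    (hjk : j ≠ k) : harmonicSpace E N j ⟂ harmonicSpace E N k := by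
  rw [harmonicSpace, harmonicSpace, Submodule.isOrtho_span]
  rintro _ ⟨y, rfl⟩ _ ⟨w, rfl⟩
  rw [inner_zonal_zonal hE hN y,
    (isGegenbauerFunctional_zonalFunctional hE (norm_eq_of_mem_sphere y)).orthogonal hN hjk]
  simp

/-- The zonal functions are, up to a constant, reproducing kernels. -/
theorem inner_zonal_harmonic (hE : Module.finrank ℝ E = N + 2) (hN : 1 ≤ N) (e : sphere (0 : E) 1)
    (k : ℕ) {f : Lp ℂ 2 (uniformSphere E)} (hf : f ∈ harmonicSpace E N k) :
    (fun x => inner ℂ (zonal N k x) f) =ᵐ[uniformSphere E] fun x =>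
      (zonalFunctional (e : E) (gegenbauer N k * gegenbauer N k) : ℂ) * f x := by
  induction hf using Submodule.span_induction with
  | mem f hf =>
    obtain ⟨y, rfl⟩ := hf
    filter_upwards [coeFn_zonal (N := N) k y] with x hx
    rw [inner_zonal_zonal hE hN e, hx, Complex.ofReal_mul, mul_comm]
  | zero =>
    filter_upwards [Lp.coeFn_zero ℂ 2 (uniformSphere E)] with x hx
    rw [hx]
    simp
  | add f g _ _ hf hg =>
    filter_upwards [hf, hg, Lp.coeFn_add f g] with x h1 h2 h3
    rw [inner_add_right, h1, h2, h3, Pi.add_apply, mul_add]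
  | smul r f _ hf =>
    filter_upwards [hf, Lp.coeFn_smul r f] with x h1 h2
    rw [inner_smul_right, h1, h2, Pi.smul_apply, smul_eq_mul, mul_left_comm]

theorem integral_norm_sq (f : Lp ℂ 2 (uniformSphere E)) :
    ∫ x, ‖f x‖ ^ 2 ∂uniformSphere E = ‖f‖ ^ 2 := by
  have h : inner ℂ f f = ∫ x, inner ℂ (f x) (f x) ∂uniformSphere E := L2.inner_def f f
  simp only [inner_self_eq_norm_sq_to_K] at h
  have h2 : ∀ x, ((‖f x‖ : ℂ)) ^ 2 = ((‖f x‖ ^ 2 : ℝ) : ℂ) := fun x => by push_cast; rfl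
  simp only [Complex.coe_algebraMap] at h
  simp only [h2, integral_complex_ofReal] at h
  exact_mod_cast h.symm

/-- Bessel's inequality for the zonal function at `x`, whose squared norm is `h` and whose
coefficients have modulus `h |v i x|`, integrated over `x`. -/
theorem card_mul_le_of_orthonormal (hE : Module.finrank ℝ E = N + 2) (hN : 1 ≤ N)
    (e : sphere (0 : E) 1) (k : ℕ) {ι : Type*} [Fintype ι] {v : ι → Lp ℂ 2 (uniformSphere E)}
    (hv : Orthonormal ℂ v) (hvk : ∀ i, v i ∈ harmonicSpace E N k) :
    Fintype.card ι * zonalFunctional (e : E) (gegenbauer N k * gegenbauer N k) ≤ 1 := by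
  have hI := isGegenbauerFunctional_zonalFunctional hE (norm_eq_of_mem_sphere e)
  set h := zonalFunctional (e : E) (gegenbauer N k * gegenbauer N k) with hh
  have h0 : 0 < h := hI.sq_pos hN k
  have hZ : ∀ x : sphere (0 : E) 1, ‖zonal N k x‖ ^ 2 = h := fun x => by
    have h1 := inner_zonal_zonal hE hN e k k x x
    rw [inner_self_eq_norm_sq_to_K, real_inner_self_eq_norm_sq, norm_eq_of_mem_sphere, one_pow,
      gegenbauer_eval_one, one_mul] at h1
    refine Complex.ofReal_injective ?_
    rw [← h1]
    push_cast
    rfl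
  have hint : ∀ i, Integrable (fun x => ‖v i x‖ ^ 2) (uniformSphere E) := fun i =>
    (Lp.memLp (v i)).integrable_norm_pow two_ne_zero
  have h1 : ∫ x, ∑ i, h ^ 2 * ‖v i x‖ ^ 2 ∂uniformSphere E ≤ ∫ _, h ∂uniformSphere E := by
    refine integral_mono_ae (integrable_finsetSum _ fun i _ => (hint i).const_mul _)
      (integrable_const _) ?_
    have h2 : ∀ᵐ x ∂uniformSphere E, ∀ i, inner ℂ (zonal N k x) (v i) = (h : ℂ) * v i x :=
      ae_all_iff.2 fun i => inner_zonal_harmonic hE hN e k (hvk i)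
    filter_upwards [h2] with x hx
    have h3 := hv.sum_inner_products_le (zonal N k x) (s := Finset.univ)
    rw [hZ] at h3
    refine le_trans (Finset.sum_le_sum fun i _ => ?_) h3
    rw [norm_inner_symm, hx i, norm_mul, mul_pow, Complex.norm_real, Real.norm_eq_abs, sq_abs]
  rw [integral_finsetSum _ fun i _ => (hint i).const_mul _] at h1
  simp only [integral_const_mul, integral_norm_sq, hv.1] at h1
  simp at h1
  have h2 : h * (Fintype.card ι * h) ≤ h * 1 := by linarith
  exact le_of_mul_le_mul_left h2 h0

theorem finite_harmonicSpace (hE : Module.finrank ℝ E = N + 2) (hN : 1 ≤ N)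
    (e : sphere (0 : E) 1) (k : ℕ) : Module.Finite ℂ (harmonicSpace E N k) := by
  have hI := isGegenbauerFunctional_zonalFunctional hE (norm_eq_of_mem_sphere e)
  set h := zonalFunctional (e : E) (gegenbauer N k * gegenbauer N k) with hh
  have h0 : 0 < h := hI.sq_pos hN k
  have hr : Module.rank ℂ (harmonicSpace E N k) ≤ ⌊h⁻¹⌋₊ := by
    refine rank_le fun s hs => ?_
    have hc := finrank_span_finset_eq_card (R := ℂ) hs
    have : FiniteDimensional ℂ (Submodule.span ℂ (s : Set (harmonicSpace E N k))) :=
      FiniteDimensional.span_finset ℂ s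
    set b := stdOrthonormalBasis ℂ (Submodule.span ℂ (s : Set (harmonicSpace E N k)))
    have ho : Orthonormal ℂ fun i => ((b i : harmonicSpace E N k) : Lp ℂ 2 (uniformSphere E)) :=
      (b.orthonormal.comp_linearIsometry (Submodule.subtypeₗᵢ _)).comp_linearIsometry
        (Submodule.subtypeₗᵢ _)
    have h1 := card_mul_le_of_orthonormal hE hN e k ho fun i => (b i : harmonicSpace E N k).2
    rw [Fintype.card_fin, hc] at h1
    refine Nat.le_floor ?_
    rwa [← one_div, le_div_iff₀ h0]
  exact Module.rank_lt_aleph0_iff.1 (hr.trans_lt (Cardinal.natCast_lt_aleph0))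

theorem finrank_harmonicSpace_mul_le (hE : Module.finrank ℝ E = N + 2) (hN : 1 ≤ N)
    (e : sphere (0 : E) 1) (k : ℕ) : Module.finrank ℂ (harmonicSpace E N k) *
      zonalFunctional (e : E) (gegenbauer N k * gegenbauer N k) ≤ 1 := by
  have := finite_harmonicSpace hE hN e k
  set b := stdOrthonormalBasis ℂ (harmonicSpace E N k)
  have h := card_mul_le_of_orthonormal hE hN e k
    (b.orthonormal.comp_linearIsometry (Submodule.subtypeₗᵢ _)) fun i => (b i).2
  rwa [Fintype.card_fin] at h

/-- The `φ_k` span all polynomials, so `f` is orthogonal to every power of `⟪·, y⟫`; hence all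
moments of its real and imaginary parts vanish. -/
theorem eq_zero_of_orthogonal_zonal (f : Lp ℂ 2 (uniformSphere E))
    (hf : ∀ k y, inner ℂ (zonal N k y) f = 0) : f = 0 := by
  have hfi : Integrable f (uniformSphere E) := (Lp.memLp f).integrable one_le_two
  have hi : ∀ (y : E) (p : ℝ[X]), Integrable (fun x : sphere (0 : E) 1 =>
      ((p.eval (inner ℝ (x : E) y) : ℝ) : ℂ) * f x) (uniformSphere E) := fun y p =>
    (memLp_continuous (f := fun x : sphere (0 : E) 1 => ((p.eval (inner ℝ (x : E) y) : ℝ) : ℂ))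
      (by fun_prop)).integrable_mul (Lp.memLp f)
  have h1 : ∀ (y : sphere (0 : E) 1) (p : ℝ[X]), ∫ x : sphere (0 : E) 1,
      ((p.eval (inner ℝ (x : E) y) : ℝ) : ℂ) * f x ∂uniformSphere E = 0 := fun y p => by
    have hp : p ∈ Submodule.span ℝ (range (gegenbauer N)) := by rw [span_gegenbauer]; trivial
    induction hp using Submodule.span_induction with
    | mem p hp =>
      obtain ⟨k, rfl⟩ := hp
      rw [← inner_zonal]
      exact hf k y
    | zero => simp
    | add p q _ _ hp hq =>
      simp only [eval_add, Complex.ofReal_add, add_mul]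
      rw [integral_add (hi y p) (hi y q), hp, hq, add_zero]
    | smul r p _ hp =>
      simp only [eval_smul, smul_eq_mul, Complex.ofReal_mul, mul_assoc]
      rw [integral_const_mul, hp, mul_zero]
  obtain ⟨e, he⟩ := exists_norm_eq E zero_le_one
  have h2 : ∀ (m : ℕ) (v : E), ∃ (r : ℝ) (y : sphere (0 : E) 1), ∀ x : E,
      inner ℝ x v ^ m = (C r * X ^ m : ℝ[X]).eval (inner ℝ x y) := fun m v => by
    rcases eq_or_ne v 0 with rfl | hv
    · refine ⟨0 ^ m, ⟨e, by simpa using he⟩, fun x => ?_⟩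
      rcases m with _ | m <;> simp
    · have hv' : ‖v‖ ≠ 0 := norm_ne_zero_iff.2 hv
      refine ⟨‖v‖ ^ m, ⟨‖v‖⁻¹ • v, by simp [norm_smul, hv']⟩, fun x => ?_⟩
      simp only [eval_mul, eval_C, eval_pow, eval_X, inner_smul_right]
      rw [← mul_pow, mul_inv_cancel_left₀ hv']
  have h3 : ∀ (m : ℕ) (v : E), ∫ x : sphere (0 : E) 1, ((inner ℝ (x : E) v ^ m : ℝ) : ℂ) * f x
      ∂uniformSphere E = 0 := fun m v => by
    obtain ⟨r, y, hr⟩ := h2 m v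
    simp only [hr]
    exact h1 y _
  have h3i : ∀ (m : ℕ) (v : E), Integrable (fun x : sphere (0 : E) 1 =>
      ((inner ℝ (x : E) v ^ m : ℝ) : ℂ) * f x) (uniformSphere E) := fun m v => by
    simpa using hi v (X ^ m)
  have hre : (fun x => (f x).re) =ᵐ[uniformSphere E] 0 := by
    refine ae_eq_zero_of_integral_pow hfi.re fun m v => ?_
    have := congrArg Complex.re (h3 m v)
    rw [← RCLike.re_eq_complex_re, ← integral_re (h3i m v)] at this
    simpa only [RCLike.re_eq_complex_re, Complex.re_ofReal_mul, Complex.zero_re] using this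
  have him : (fun x => (f x).im) =ᵐ[uniformSphere E] 0 := by
    refine ae_eq_zero_of_integral_pow hfi.im fun m v => ?_
    have := congrArg Complex.im (h3 m v)
    rw [← RCLike.im_eq_complex_im, ← integral_im (h3i m v)] at this
    simpa only [RCLike.im_eq_complex_im, Complex.im_ofReal_mul, Complex.zero_im] using this
  rw [Lp.eq_zero_iff_ae_eq_zero]
  filter_upwards [hre, him] with x h4 h5
  exact Complex.ext h4 h5

/-- A Hilbert basis of `L²` of the sphere diagonalizing all averaging operators. -/
theorem exists_hilbertBasis_eigenvectors (hE : Module.finrank ℝ E = N + 2) (hN : 1 ≤ N)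
    (hE' : 2 ≤ Module.finrank ℝ E) (e : sphere (0 : E) 1) :
    ∃ (d : ℕ → ℕ) (b : HilbertBasis (Σ k, Fin (d k)) ℂ (Lp ℂ 2 (uniformSphere E))),
      (∀ k, d k * zonalFunctional (e : E) (gegenbauer N k * gegenbauer N k) ≤ 1) ∧
      ∀ (δ : Icc (-1 : ℝ) 1) (a : Σ k, Fin (d k)), sphereAverage hE' δ (b a) =
        (((gegenbauer N a.1).eval (δ : ℝ) : ℝ) : ℂ) • b a := by
  have := finite_harmonicSpace hE hN e
  set u := fun k => stdOrthonormalBasis ℂ (harmonicSpace E N k) with hu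
  have hfam : OrthogonalFamily ℂ (fun k => harmonicSpace E N k)
      fun k => (harmonicSpace E N k).subtypeₗᵢ :=
    OrthogonalFamily.of_pairwise fun j k hjk => orthogonal_harmonicSpace hE hN hjk
  have ho := hfam.orthonormal_sigma_orthonormal fun k => (u k).orthonormal
  refine ⟨fun k => Module.finrank ℂ (harmonicSpace E N k),
    HilbertBasis.mkOfOrthogonalEqBot ho ?_, fun k => finrank_harmonicSpace_mul_le hE hN e k,
    fun δ a => ?_⟩
  · rw [eq_bot_iff]
    intro f hf
    rw [Submodule.mem_bot]
    refine eq_zero_of_orthogonal_zonal (N := N) f fun k y => ?_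
    rw [Submodule.mem_orthogonal] at hf
    refine hf _ ?_
    have hy : zonal N k y ∈ harmonicSpace E N k := Submodule.subset_span ⟨y, rfl⟩
    have h1 := congrArg Subtype.val ((u k).sum_repr ⟨zonal N k y, hy⟩)
    rw [Submodule.coe_sum] at h1
    change _ = zonal N k y at h1
    rw [← h1]
    exact Submodule.sum_mem _ fun i _ =>
      Submodule.smul_mem _ _ (Submodule.subset_span ⟨⟨k, i⟩, rfl⟩)
  · rw [HilbertBasis.coe_mkOfOrthogonalEqBot]
    exact sphereAverage_harmonic hE hN hE' δ a.1 (u a.1 a.2).2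

end Harmonic

/-! ### Operators diagonal in a Hilbert basis: functional calculus, Schatten norm, compactness. -/

section Diagonal

variable {H : Type*} [NormedAddCommGroup H] [InnerProductSpace ℂ H] [CompleteSpace H]

theorem mem_spectrum_of_eigenvector {a : H →L[ℂ] H} {v : H} (hv : v ≠ 0) {μ : ℝ}
    (h : a v = (μ : ℂ) • v) : μ ∈ spectrum ℝ a := by
  intro hu
  obtain ⟨w, hw⟩ := hu.exists_left_inv
  apply hv
  have h1 : (algebraMap ℝ (H →L[ℂ] H) μ - a) v = 0 := by
    rw [Algebra.algebraMap_eq_smul_one, sub_apply, h]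
    simp
  have h2 := congrArg (fun u : H →L[ℂ] H => u v) hw
  simpa [h1] using h2.symm

/-- The identity is preserved by algebraic operations and uniform limits, so Stone–Weierstrass
reduces it to constants and the identity function. -/
theorem cfc_apply_eigenvector {a : H →L[ℂ] H} (ha : IsSelfAdjoint a) {v : H} (hv : v ≠ 0) {μ : ℝ}
    (h : a v = (μ : ℂ) • v) (f : ℝ → ℝ) (hf : ContinuousOn f (spectrum ℝ a)) :
    cfc f a v = (f μ : ℂ) • v := by
  have hμ := mem_spectrum_of_eigenvector hv h
  have key : ∀ g : C(spectrum ℝ a, ℝ), cfcHom (R := ℝ) ha g v = (g ⟨μ, hμ⟩ : ℂ) • v := by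
    intro g
    induction g using ContinuousMap.induction_on_of_compact with
    | const r =>
      have : ContinuousMap.const (spectrum ℝ a) r = algebraMap ℝ C(spectrum ℝ a, ℝ) r := rfl
      rw [this, AlgHomClass.commutes, Algebra.algebraMap_eq_smul_one]
      simp
    | id =>
      have := cfcHom_id (R := ℝ) ha
      rw [this, h]
      rfl
    | star_id =>
      have := cfcHom_id (R := ℝ) ha
      rw [map_star, this, ha.star_eq, h]
      rfl
    | add f g hf hg =>
      rw [map_add, add_apply, hf, hg, ← add_smul]
      simp
    | mul f g hf hg =>
      rw [map_mul, mul_apply_eq_comp, hg, map_smul, hf, smul_smul]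
      simp [mul_comm]
    | frequently f hf =>
      have hc : IsClosed {g : C(spectrum ℝ a, ℝ) | cfcHom (R := ℝ) ha g v =
          (g ⟨μ, hμ⟩ : ℂ) • v} := by
        refine isClosed_eq ?_ ?_
        · exact (ContinuousLinearMap.apply ℂ H v).continuous.comp (cfcHom_continuous ha)
        · exact (Complex.continuous_ofReal.comp (continuous_eval_const _)).smul continuous_const
      exact hc.closure_subset (mem_closure_of_frequently_of_tendsto hf Filter.tendsto_id)
  rw [cfc_apply f a ha hf, key]
  rfl

variable {ι : Type*} {b : HilbertBasis ι ℂ H} {T : H →L[ℂ] H} {c : ι → ℝ}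

theorem inner_basis_diagonal (hT : ∀ i, T (b i) = (c i : ℂ) • b i) (i : ι) (x : H) :
    inner ℂ (b i) (T x) = c i * inner ℂ (b i) x := by
  classical
  have h : (innerSL ℂ (b i)).comp T = (c i : ℂ) • innerSL ℂ (b i) := by
    refine ContinuousLinearMap.ext_on (s := range b)
      (Submodule.dense_iff_topologicalClosure_eq_top.2 b.dense_span) ?_
    rintro _ ⟨j, rfl⟩
    simp only [ContinuousLinearMap.comp_apply, smul_apply, innerSL_apply_apply,
      hT, inner_smul_right, orthonormal_iff_ite.1 b.orthonormal, smul_eq_mul]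
    split_ifs with hij
    · rw [hij]
    · simp
  simpa using congrArg (fun u => u x) h

theorem isSelfAdjoint_diagonal (hT : ∀ i, T (b i) = (c i : ℂ) • b i) : IsSelfAdjoint T := by
  rw [ContinuousLinearMap.isSelfAdjoint_iff_isSymmetric]
  intro x y
  change inner ℂ (T x) y = inner ℂ x (T y)
  refine (b.hasSum_inner_mul_inner (T x) y).unique ?_
  convert b.hasSum_inner_mul_inner x (T y) using 2 with i
  rw [inner_basis_diagonal hT, ← inner_conj_symm, inner_basis_diagonal hT, map_mul,
    inner_conj_symm, Complex.conj_ofReal]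
  ring

theorem norm_le_diagonal (hT : ∀ i, T (b i) = (c i : ℂ) • b i) {C : ℝ} (hC : 0 ≤ C)
    (hc : ∀ i, |c i| ≤ C) : ‖T‖ ≤ C := by
  refine T.opNorm_le_bound hC fun x => ?_
  have h1 : ∀ i, ENNReal.ofReal (‖inner ℂ (b i) (T x)‖ ^ 2) ≤
      ENNReal.ofReal (C ^ 2) * ENNReal.ofReal (‖inner ℂ (b i) x‖ ^ 2) := fun i => by
    rw [← ENNReal.ofReal_mul (by positivity), inner_basis_diagonal hT, norm_mul, mul_pow,
      Complex.norm_real, Real.norm_eq_abs]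
    have := hc i
    gcongr
  have h2 := ENNReal.tsum_le_tsum h1
  rw [ENNReal.tsum_mul_left, parseval, parseval, ← ENNReal.ofReal_mul (by positivity),
    ENNReal.ofReal_le_ofReal_iff (by positivity), ← mul_pow] at h2
  exact le_of_sq_le_sq h2 (by positivity)

theorem posTrace_abs_rpow_diagonal (hT : ∀ i, T (b i) = (c i : ℂ) • b i) {q : ℝ} (hq : 0 ≤ q) :
    posTrace (CFC.abs T ^ q) = ∑' i, ENNReal.ofReal (|c i| ^ q) := by
  have hsa := isSelfAdjoint_diagonal hT
  have hb : ∀ i, b i ≠ 0 := fun i => b.orthonormal.ne_zero i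
  have habs : ∀ i, CFC.abs T (b i) = ((|c i| : ℝ) : ℂ) • b i := fun i => by
    rw [CFC.abs_eq_cfc_norm T hsa, cfc_apply_eigenvector hsa (hb i) (hT i) _ (by fun_prop)]
    simp
  rw [posTrace_eq b CFC.rpow_nonneg]
  congr with i
  rw [CFC.rpow_eq_cfc_real, cfc_apply_eigenvector (CFC.abs_nonneg T).isSelfAdjoint (hb i) (habs i)
    _ (Real.continuous_rpow_const hq).continuousOn, inner_smul_right,
    inner_self_eq_norm_sq_to_K, b.orthonormal.1 i]
  simp

theorem schattenNorm_diagonal (hT : ∀ i, T (b i) = (c i : ℂ) • b i) {p : ℝ≥0∞} (hp : p ≠ ∞) :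
    schattenNorm p T = (∑' i, ENNReal.ofReal (|c i| ^ p.toReal)) ^ (1 / p.toReal) := by
  rw [schattenNorm, if_neg hp, posTrace_abs_rpow_diagonal hT ENNReal.toReal_nonneg]

/-- The finite rank truncations converge in norm, since each error is again diagonal with only the
remaining entries. -/
theorem isCompactOperator_diagonal (hT : ∀ i, T (b i) = (c i : ℂ) • b i)
    (hc : Filter.Tendsto c Filter.cofinite (nhds 0)) : IsCompactOperator T := by
  classical
  set F : Finset ι → H →L[ℂ] H := fun s =>
    ∑ i ∈ s, ((c i : ℂ) • innerSL ℂ (b i)).smulRight (b i) with hF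
  refine isCompactOperator_of_tendsto (l := Filter.atTop) (F := F) ?_ (.of_forall fun s => ?_)
  · rw [Metric.tendsto_atTop]
    intro ε hε
    have h := hc.eventually (Metric.ball_mem_nhds 0 (half_pos hε))
    rw [Filter.eventually_cofinite] at h
    refine ⟨h.toFinset, fun s hs => ?_⟩
    have hFb : ∀ i, (F s - T) (b i) = ((if i ∈ s then 0 else -c i : ℝ) : ℂ) • b i := fun i => by
      rw [sub_apply, hT, hF, sum_apply]
      simp only [ContinuousLinearMap.smulRight_apply, smul_apply,
        innerSL_apply_apply, orthonormal_iff_ite.1 b.orthonormal, smul_eq_mul, mul_ite, mul_one,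
        mul_zero, ite_smul, zero_smul, Finset.sum_ite_eq']
      split_ifs <;> simp
    rw [dist_eq_norm]
    refine lt_of_le_of_lt (norm_le_diagonal hFb (half_pos hε).le fun i => ?_) (half_lt_self hε)
    split_ifs with hi
    · simpa using (half_pos hε).le
    · have : i ∉ h.toFinset := fun h => hi (hs h)
      simp at this
      rw [abs_neg]
      exact this.le
  · refine (compactOperator (RingHom.id ℂ) H H).sum_mem fun i _ => ?_
    exact (isCompactOperator_of_locallyCompactSpace_dom ((c i : ℂ) • innerSL ℂ (b i))).clm_comp
      (ContinuousLinearMap.toSpanSingleton ℂ (b i))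

end Diagonal

/-! ### Summing eigenvalues with multiplicity. -/

section Bounds

/-- The multiplicity costs `1 / h` and the eigenvalue gains `h^(q/2)`. The remaining exponent `q/2 -
1` is nonnegative, so the upper bound on `h` applies. -/
theorem mul_rpow_le_of_sqrt_bound {N : ℕ} {d h K M l x α q : ℝ} (hh : 0 < h) (hK : 0 ≤ K)
    (hx : 0 < x) (hM : 0 ≤ M) (hd : d * h ≤ 1) (hle : h ≤ K / x ^ N) (hq : 2 ≤ q)
    (hl : |l| ≤ M * (√h * x ^ α)) :
    d * |l| ^ q ≤ M ^ q * (K ^ (q / 2 - 1) * x ^ (α * q - N * (q / 2 - 1))) := by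
  have h1 : |l| ^ q ≤ M ^ q * (h ^ (q / 2) * x ^ (α * q)) := by
    refine (Real.rpow_le_rpow (abs_nonneg _) hl (by linarith)).trans_eq ?_
    rw [Real.mul_rpow hM (by positivity), Real.mul_rpow (by positivity) (by positivity),
      Real.sqrt_eq_rpow, ← Real.rpow_mul hh.le, ← Real.rpow_mul hx.le]
    rw [one_div_mul_eq_div]
  have hdh : d ≤ h⁻¹ := by rwa [← one_div, le_div_iff₀ hh]
  have h2 : h ^ (q / 2 - 1) ≤ K ^ (q / 2 - 1) * x ^ (-(N * (q / 2 - 1))) := by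
    refine (Real.rpow_le_rpow hh.le hle (by linarith)).trans_eq ?_
    rw [Real.div_rpow hK (by positivity), ← Real.rpow_natCast, ← Real.rpow_mul hx.le,
      Real.rpow_neg hx.le, div_eq_mul_inv]
  calc d * |l| ^ q ≤ h⁻¹ * (M ^ q * (h ^ (q / 2) * x ^ (α * q))) :=
        mul_le_mul hdh h1 (by positivity) (by positivity)
    _ = M ^ q * (h ^ (q / 2 - 1) * x ^ (α * q)) := by
        rw [Real.rpow_sub_one hh.ne']
        field_simp
    _ ≤ M ^ q * ((K ^ (q / 2 - 1) * x ^ (-(N * (q / 2 - 1)))) * x ^ (α * q)) := by gcongr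
    _ = _ := by
        rw [mul_assoc (K ^ (q / 2 - 1)), ← Real.rpow_add hx]
        congr 3
        ring

/-- The `ℓ^q` norm of a sequence repeated with multiplicities `d k ≤ 1 / h k`. -/
theorem exists_tsum_rpow_le {N : ℕ} {d : ℕ → ℕ} {h : ℕ → ℝ} {K α q : ℝ} (hh : ∀ k, 0 < h k)
    (hK : 0 ≤ K) (hd : ∀ k, d k * h k ≤ 1) (hle : ∀ k, h k ≤ K / (k + 1 : ℝ) ^ N) (hq : 2 ≤ q)
    (hα : 1 + α * q < N * (q / 2 - 1)) :
    ∃ S : ℝ, 0 ≤ S ∧ ∀ (l : ℕ → ℝ) (M : ℝ), 0 ≤ M →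
      (∀ k : ℕ, |l k| ≤ M * (√(h k) * (k + 1 : ℝ) ^ α)) →
      ∑' a : Σ k, Fin (d k), ENNReal.ofReal (|l a.1| ^ q) ≤ ENNReal.ofReal (M ^ q * S) := by
  have hs : Summable fun k : ℕ => K ^ (q / 2 - 1) * (k + 1 : ℝ) ^ (α * q - N * (q / 2 - 1)) := by
    have := (summable_nat_add_iff 1).2
      (Real.summable_nat_rpow (p := α * q - N * (q / 2 - 1)) |>.2 (by linarith))
    push_cast at this
    exact this.mul_left _
  refine ⟨∑' k : ℕ, K ^ (q / 2 - 1) * (k + 1 : ℝ) ^ (α * q - N * (q / 2 - 1)),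
    tsum_nonneg fun k => by positivity, fun l M hM hl => ?_⟩
  rw [← tsum_mul_left, ENNReal.ofReal_tsum_of_nonneg (fun k => by positivity) (hs.mul_left _),
    ENNReal.tsum_sigma']
  refine ENNReal.tsum_le_tsum fun k => ?_
  dsimp only
  rw [tsum_fintype, Finset.sum_const, Finset.card_univ, Fintype.card_fin, nsmul_eq_mul,
    ← ENNReal.ofReal_natCast, ← ENNReal.ofReal_mul (by positivity)]
  exact ENNReal.ofReal_le_ofReal (mul_rpow_le_of_sqrt_bound (hh k) hK (by positivity) hM (hd k)
    (hle k) hq (hl k))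

theorem tendsto_cofinite_of_tsum_rpow {ι : Type*} {c : ι → ℝ} {q : ℝ} (hq : 0 < q)
    (h : ∑' i, ENNReal.ofReal (|c i| ^ q) ≠ ∞) :
    Filter.Tendsto c Filter.cofinite (nhds 0) := by
  have h1 := ENNReal.tendsto_cofinite_zero_of_tsum_ne_top h
  have h2 := (ENNReal.tendsto_toReal ENNReal.zero_ne_top).comp h1
  have h3 := ((Real.continuous_rpow_const (inv_pos.2 hq).le).tendsto _).comp h2
  rw [tendsto_zero_iff_abs_tendsto_zero]
  simp only [ENNReal.toReal_zero, Real.zero_rpow (inv_pos.2 hq).ne'] at h3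
  refine h3.congr fun i => ?_
  simp only [Function.comp_apply]
  rw [ENNReal.toReal_ofReal (by positivity), Real.rpow_rpow_inv (abs_nonneg _) hq.ne']

variable {H : Type*} [NormedAddCommGroup H] [InnerProductSpace ℂ H] [CompleteSpace H]

/-- The Schatten bound for diagonal operators with multiplicities. -/
theorem exists_schatten_bound {N : ℕ} (hN : 1 ≤ N) {d : ℕ → ℕ} {h : ℕ → ℝ} {K : ℝ}
    (hh : ∀ k, 0 < h k) (hK : 0 ≤ K) (hd : ∀ k, d k * h k ≤ 1)
    (hle : ∀ k, h k ≤ K / (k + 1 : ℝ) ^ N) (b : HilbertBasis (Σ k, Fin (d k)) ℂ H) {p : ℝ≥0∞}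
    (hp : ENNReal.ofReal (2 + 2 / N) < p) :
    ∃ C α : ℝ, 0 ≤ C ∧ 0 < α ∧ α < 1 ∧ ∀ (T : H →L[ℂ] H) (l : ℕ → ℝ) (M : ℝ), 0 ≤ M →
      (∀ a, T (b a) = (l a.1 : ℂ) • b a) →
      (∀ k : ℕ, |l k| ≤ M * (√(h k) * (k + 1 : ℝ) ^ α)) →
      MemSchatten p T ∧ schattenNorm p T ≤ ENNReal.ofReal (C * M) := by
  have hN' : (0 : ℝ) < N := by exact_mod_cast hN
  -- For `p = ∞` any finite exponent above the threshold serves: an `ℓ^q` family tends to zero, and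
  -- its supremum is at most its `ℓ^q` norm.
  obtain ⟨q, hq, hpq⟩ : ∃ q : ℝ, 2 + 2 / N < q ∧ (p ≠ ∞ → p.toReal = q) := by
    by_cases hp' : p = ∞
    · exact ⟨_, lt_add_one _, fun h => absurd hp' h⟩
    · exact ⟨p.toReal, (ENNReal.ofReal_lt_iff_lt_toReal (by positivity) hp').1 hp, fun _ => rfl⟩
  have h2q : 2 < q := lt_trans (lt_add_of_pos_right _ (by positivity)) hq
  have hs : 0 < N * (q / 2 - 1) - 1 := by
    have h1 : N * (2 + 2 / N) < N * q := by gcongr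
    have h2 : N * (2 + 2 / N : ℝ) = 2 * N + 2 := by field_simp
    linarith
  have hq0 : 0 < q := by linarith
  -- The second entry spends half of the slack in `N (q/2 - 1) > 1`; the first keeps `α` below `1`.
  set α := min (1 / 2) ((N * (q / 2 - 1) - 1) / (2 * q)) with hα
  have hα0 : 0 < α := lt_min (by norm_num) (by positivity)
  have hα1 : α < 1 := (min_le_left _ _).trans_lt (by norm_num)
  have hαq : 1 + α * q < N * (q / 2 - 1) := by
    have h1 : α * q ≤ (N * (q / 2 - 1) - 1) / (2 * q) * q := by
      gcongr
      exact min_le_right _ _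
    have h2 : (N * (q / 2 - 1) - 1) / (2 * q) * q = (N * (q / 2 - 1) - 1) / 2 := by field_simp
    linarith
  obtain ⟨S, hS, hbound⟩ := exists_tsum_rpow_le hh hK hd hle h2q.le hαq
  refine ⟨S ^ (1 / q), α, by positivity, hα0, hα1, fun T l M hM hT hl => ?_⟩
  have hsum := hbound l M hM hl
  have hroot : (M ^ q * S) ^ (1 / q) = S ^ (1 / q) * M := by
    rw [Real.mul_rpow (by positivity) hS, one_div, Real.rpow_rpow_inv hM hq0.ne', mul_comm]
  by_cases hp' : p = ∞
  · constructor
    · rw [MemSchatten, if_pos hp']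
      exact isCompactOperator_diagonal hT
        (tendsto_cofinite_of_tsum_rpow hq0 (hsum.trans_lt ENNReal.ofReal_lt_top).ne)
    · rw [schattenNorm, if_pos hp', ← ofReal_norm]
      refine ENNReal.ofReal_le_ofReal (norm_le_diagonal hT (by positivity) fun a => ?_)
      have h1 := (ENNReal.le_tsum a).trans hsum
      rw [ENNReal.ofReal_le_ofReal_iff (by positivity)] at h1
      have h2 := Real.rpow_le_rpow (by positivity) h1 (by positivity : 0 ≤ 1 / q)
      rwa [hroot, one_div q, Real.rpow_rpow_inv (abs_nonneg _) hq0.ne', ← one_div] at h2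
  · have hb : schattenNorm p T ≤ ENNReal.ofReal (S ^ (1 / q) * M) := by
      rw [schattenNorm_diagonal hT hp', hpq hp', ← hroot,
        ← ENNReal.ofReal_rpow_of_nonneg (by positivity) (by positivity)]
      exact ENNReal.rpow_le_rpow hsum (by positivity)
    refine ⟨?_, hb⟩
    rw [MemSchatten, if_neg hp']
    exact hb.trans_lt ENNReal.ofReal_lt_top

end Bounds

end SphereMean

/-! ### The averaging operators on the Euclidean sphere. -/

theorem proposition3p1 (n : ℕ) (hn : 3 ≤ n) (p : ℝ≥0∞)
    (hp : ENNReal.ofReal (2 + 2 / ((n : ℝ) - 2)) < p) :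
    (∀ δ : Set.Icc (-1 : ℝ) 1, |(δ : ℝ)| < 1 →
      SphereMean.MemSchatten p (SphereMean.avgOp n hn δ)) ∧
    ∃ C α : ℝ, 2 ≤ C ∧ 0 < α ∧ α < 1 ∧
      ∀ δ : Set.Icc (-1 : ℝ) 1, |(δ : ℝ)| ≤ 1 / 2 →
        SphereMean.MemSchatten p
          (SphereMean.avgOp n hn ⟨0, by norm_num⟩ - SphereMean.avgOp n hn δ) ∧
        SphereMean.schattenNorm p
          (SphereMean.avgOp n hn ⟨0, by norm_num⟩ - SphereMean.avgOp n hn δ) ≤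
            ENNReal.ofReal (C * |(δ : ℝ)| ^ α) := by
  obtain ⟨N, rfl⟩ : ∃ N, n = N + 2 := ⟨n - 2, by omega⟩
  have hN : 1 ≤ N := by omega
  have hE : Module.finrank ℝ (EuclideanSpace ℝ (Fin (N + 2))) = N + 2 := finrank_euclideanSpace_fin
  rw [show ((N + 2 : ℕ) : ℝ) - 2 = N by push_cast; ring] at hp
  obtain ⟨e⟩ : Nonempty (sphere (0 : EuclideanSpace ℝ (Fin (N + 2))) 1) :=
    (NormedSpace.sphere_nonempty.2 zero_le_one).to_subtype
  have hI := SphereMean.isGegenbauerFunctional_zonalFunctional hE (norm_eq_of_mem_sphere e)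
  obtain ⟨d, b, hd, hb⟩ := SphereMean.exists_hilbertBasis_eigenvectors hE hN (by omega) e
  obtain ⟨C, α, hC, hα0, hα1, hbound⟩ := SphereMean.exists_schatten_bound hN (hI.sq_pos hN)
    (Nat.cast_nonneg _) hd (hI.sq_le hN) b hp
  -- A single operator needs no factor `(k + 1)^α`, which is at least `1` and may be inserted. For
  -- the difference, diagonal in the same basis, `|δ|^α` is part of the constant `M`; the maximum
  -- with `2` only secures `C ≥ 2`.
  refine ⟨fun δ hδ => (hbound (SphereMean.avgOp (N + 2) hn δ)
    (fun k => (SphereMean.gegenbauer N k).eval (δ : ℝ)) (√(2 / (1 - (δ : ℝ) ^ 2) ^ N))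
    (Real.sqrt_nonneg _) (fun a => hb δ a) fun k => ?_).1,
    max 2 (C * (2 * √((N + 1) * 2 ^ (N + 2)))), α, le_max_left _ _, hα0, hα1, fun δ hδ => ?_⟩
  · refine (hI.abs_eval_le k hδ).trans (mul_le_mul_of_nonneg_left ?_ (Real.sqrt_nonneg _))
    exact le_mul_of_one_le_right (Real.sqrt_nonneg _)
      (Real.one_le_rpow (by linarith [(Nat.cast_nonneg k : (0 : ℝ) ≤ k)]) hα0.le)
  · obtain ⟨h1, h2⟩ := hbound (SphereMean.avgOp (N + 2) hn ⟨0, by norm_num⟩ -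
      SphereMean.avgOp (N + 2) hn δ)
      (fun k => (SphereMean.gegenbauer N k).eval 0 - (SphereMean.gegenbauer N k).eval (δ : ℝ))
      (2 * √((N + 1) * 2 ^ (N + 2)) * |(δ : ℝ)| ^ α) (by positivity)
      (fun a => by
        rw [sub_apply, Complex.ofReal_sub, sub_smul]
        exact congrArg₂ _ (hb _ a) (hb δ a))
      (fun k => (hI.abs_eval_sub_le k hδ hα0.le hα1.le).trans_eq (by
        rw [Real.mul_rpow (by positivity) (abs_nonneg _)]
        ring))
    refine ⟨h1, h2.trans (ENNReal.ofReal_le_ofReal ?_)⟩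
    rw [← mul_assoc]
    exact mul_le_mul_of_nonneg_right (le_max_right _ _) (by positivity)
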